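/- Let $H\in(\tfrac12,1)$. A Gaussian process $X=(X(t))_{t\in[0,1]}$ is said to be of type $H$ if it is centred and the function $f(s,t)=\mathbb{E}\,(X(t)-X(s))^2$ is $\mathcal{C}^1$ on $(0,1)^2$, the mixed derivative $\partial_s\partial_t f$ exists off the diagonal, and there are constants $c_1,c_2,c_3>0$ such that $$c_1|t-s|^{2H}\le f(s,t)\le c_2|t-s|^{2H},\qquad |\partial_s\partial_t f(s,t)|\le c_3|t-s|^{2H-2}$$ for all $s\neq t$ in $(0,1)$. Let $B=(B^1,\dots,B^m)$ consist of $m$ i.i.d. Gaussian processes of type $H$ with almost surely continuous sample paths on $[0,1]$. For $\alpha\in(0,1)$ let $\|g\|_\alpha=\sup_{[0,1]}|g|+\sup_{s\neq t}|g(t)-g(s)|/|t-s|^\alpha$ denote the $\alpha$-Hölder norm on $[0,1]$ and let $\|g\|_\infty=\sup_{t\in[0,1]}|g(t)|$ (with the Euclidean norm if $g$ is $\mathbb{R}^m$-valued). Let $a$ and $b=(b^1,\dots,b^m)$ be processes on $[0,1]$, on the same probability space, with values in $\mathbb{R}$ and $\mathbb{R}^m$ and almost surely continuous paths, such that $$\mathbb{E}\Bigl(\|a\|_{\tilde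 H}+\sum_{i=1}^m\|b^i\|_{\tilde H}\Bigr)^p<\infty\qquad\text{for every } p\ge1 \text{ and every } \tilde H\in(\tfrac12,H).$$ No independence of $(a,b)$ from $B$ and no adaptedness is assumed. Then almost surely all the pathwise Young (Riemann–Stieltjes) integrals $\int_0^t b^i(s)\,dB^i(s)$, $t\in[0,1]$, $1\le i\le m$, exist, and for $$y_t=\int_0^t a(s)\,ds+\sum_{i=1}^m\int_0^t b^i(s)\,dB^i(s),\qquad t\in[0,1],$$ there exists $q>0$ such that for every $p>0$ there is a constant $C_p$ with $$\mathbb{P}\bigl(\|y\|_\infty<\epsilon\ \text{ and }\ \|a\|_\infty+\|b\|_\infty>\epsilon^q\bigr)<C_p\,\epsilon^p\qquad\text{for every } \epsilon>0 .$$ The constant $C_p$ does not depend on $\epsilon$. -/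

import Mathlib

open MeasureTheory ProbabilityTheory Set
open scoped NNReal ENNReal

/-- `I` is the Young (Riemann–Stieltjes) integral `∫_u^v f dg`: the tagged sums
`∑ f(ξ_k) (g(t_{k+1}) - g(t_k))` over partitions `u = t_0 ≤ t_1 ≤ … ≤ t_n = v` with tags
`ξ_k ∈ [t_k, t_{k+1}]` converge to `I` as the mesh of the partition tends to zero. -/
def HasYoungIntegral (f g : ℝ → ℝ) (u v I : ℝ) : Prop :=
  ∀ ε : ℝ, 0 < ε → ∃ δ : ℝ, 0 < δ ∧ ∀ (n : ℕ) (t ξ : ℕ → ℝ), Monotone t → t 0 = u → t n = v →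
    (∀ k < n, t (k + 1) - t k < δ) → (∀ k < n, ξ k ∈ Icc (t k) (t (k + 1))) →
    |∑ k ∈ Finset.range n, f (ξ k) * (g (t (k + 1)) - g (t k)) - I| < ε

open Classical in
/-- The Young integral `∫_u^v f dg` (zero if the Riemann–Stieltjes sums do not converge). -/
noncomputable def youngIntegral (f g : ℝ → ℝ) (u v : ℝ) : ℝ :=
  if h : ∃ I, HasYoungIntegral f g u v I then h.choose else 0

/-- The supremum norm on `[0,1]`. -/
noncomputable def supNorm {E : Type*} [NormedAddCommGroup E] (f : ℝ → E) : ℝ≥0∞ :=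
  ⨆ t ∈ Icc (0 : ℝ) 1, ‖f t‖ₑ

/-- The `r`-Hölder norm on `[0,1]`: the supremum norm plus the `r`-Hölder seminorm. -/
noncomputable def holderNorm (r : ℝ≥0) (f : ℝ → ℝ) : ℝ≥0∞ :=
  supNorm f + eHolderNorm r (fun t : Icc (0 : ℝ) 1 => f t)

/-- The variance function `f(s,t) = E (X(t) - X(s))²` of the increments of a process. -/
noncomputable def incrVar {Ω : Type*} [MeasurableSpace Ω] (P : Measure Ω) (X : ℝ → Ω → ℝ)
    (s t : ℝ) : ℝ :=
  ∫ ω, (X t ω - X s ω) ^ 2 ∂P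

/-- The process `X`, considered on the time interval `[0,1]`, is a Gaussian process of type `H`. -/
structure IsGaussianOfType {Ω : Type*} [MeasurableSpace Ω] (P : Measure Ω) (H : ℝ)
    (X : ℝ → Ω → ℝ) : Prop where
  gaussian : IsGaussianProcess (fun t : Icc (0 : ℝ) 1 => X t) P
  centred : ∀ t ∈ Icc (0 : ℝ) 1, ∫ ω, X t ω ∂P = 0
  contDiffOn : ContDiffOn ℝ 1 (fun z : ℝ × ℝ => incrVar P X z.1 z.2)
    (Ioo (0 : ℝ) 1 ×ˢ Ioo (0 : ℝ) 1)
  bounds : ∃ c₁ c₂ c₃ : ℝ, 0 < c₁ ∧ 0 < c₂ ∧ 0 < c₃ ∧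
    ∀ s ∈ Ioo (0 : ℝ) 1, ∀ t ∈ Ioo (0 : ℝ) 1, s ≠ t →
    c₁ * |t - s| ^ (2 * H) ≤ incrVar P X s t ∧
    incrVar P X s t ≤ c₂ * |t - s| ^ (2 * H) ∧
    DifferentiableAt ℝ (fun s' => deriv (fun t' => incrVar P X s' t') t) s ∧
    |deriv (fun s' => deriv (fun t' => incrVar P X s' t') t) s| ≤ c₃ * |t - s| ^ (2 * H - 2)

/-- The process `y_t = ∫_0^t a(s) ds + ∑_i ∫_0^t b^i(s) dB^i(s)`, with pathwise Young integrals. -/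
noncomputable def norrisProcess {Ω : Type*} {m : ℕ} (a : ℝ → Ω → ℝ)
    (b : ℝ → Ω → EuclideanSpace ℝ (Fin m)) (B : Fin m → ℝ → Ω → ℝ) (t : ℝ) (ω : Ω) : ℝ :=
  (∫ s in (0 : ℝ)..t, a s ω) +
    ∑ i, youngIntegral (fun s => b s ω i) (fun s => B i s ω) 0 t

/-! Fix α in (1/2, H). Off an event of probability O(ε^p), for any p, the α-Hölder constants of `a`,
`b`, `B` and the suprema of `a`, `b` are at most Λ = ε^(-κ): this follows from the moment hypothesis
and, for `B`, from Kolmogorov's dyadic argument. On such paths the Young–Loève estimate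
(`young_loeve`) gives y(u+ε) - y(u) = ∫ a + ∑ b^i(u) (B^i(u+ε) - B^i(u)) + O(Λ² ε^(2α)). Since 2α >
1, |y| ≤ ε forces the sum to be O(Λ² ε). If some |b^i| exceeds ε^β, the natural size of the sum is
at least ε^(β+H), which is much larger because β + H < 1.

A single atypically small increment is not rare enough, but K of them at spacing Lε are nearly
uncorrelated: the bound on the mixed derivative makes their covariance matrix diagonally dominant
for large L (`IsGaussianOfType.variance_lower`), and the joint probability is at most (cε^ρ)^K with
ρ = 1 - 3κ - β - H. As `b` may depend on `B`, it is first frozen at a point of a time grid of mesh ε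
and rounded to the lattice of mesh ε. The union bound over these deterministic choices costs a fixed
power of ε, which a large K beats (`smallBall_union`).

So each |b^i| is at most 2ε^β off a negligible event. Over a window of length ε^β all contributions
to y other than the drift are then of smaller order than ε^(β+κ), hence `a` is small too
(`abs_drift_mul_le`). The pathwise part of the argument is collected in `norris_dichotomy`. -/

open Filter Topology

/-! ### Hölder paths and the Young integral -/

/-- The function `f` is `α`-Hölder on `[0,1]` with constant `Λ`. -/
def HolderBdd (α Λ : ℝ) (f : ℝ → ℝ) : Prop :=
  ∀ s ∈ Icc (0 : ℝ) 1, ∀ t ∈ Icc (0 : ℝ) 1, |f t - f s| ≤ Λ * |t - s| ^ α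

theorem continuous_of_holder {α M : ℝ} (hα : 0 < α) {g : ℝ → ℝ}
    (hg : ∀ s t, |g t - g s| ≤ M * |t - s| ^ α) : Continuous g := by
  rw [continuous_iff_continuousAt]
  intro x
  rw [ContinuousAt, tendsto_iff_dist_tendsto_zero]
  have h : Tendsto (fun t => M * |t - x| ^ α) (𝓝 x) (𝓝 0) := by
    have : Continuous fun t : ℝ => M * |t - x| ^ α := by
      refine continuous_const.mul (Continuous.rpow_const (by fun_prop) fun _ => Or.inr hα.le)
    have h := this.tendsto x
    simpa [Real.zero_rpow hα.ne'] using h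
  exact squeeze_zero (fun _ => dist_nonneg) (fun t => by rw [Real.dist_eq]; exact hg x t) h

/-- The regularised integral `∫_u^v f(s) (g(s+h) - g(s)) / h ds`. -/
noncomputable def regInt (f g : ℝ → ℝ) (h u v : ℝ) : ℝ :=
  h⁻¹ * ∫ s in u..v, f s * (g (s + h) - g s)

theorem regInt_add {f g : ℝ → ℝ} (hf : Continuous f) (hg : Continuous g) (h u v w : ℝ) :
    regInt f g h u v + regInt f g h v w = regInt f g h u w := by
  unfold regInt
  rw [← mul_add, intervalIntegral.integral_add_adjacent_intervals] <;>
    exact Continuous.intervalIntegrable (by fun_prop) _ _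

/-- The regularised integral of 1 is the average of g over [v, v+h] minus its average over [u, u+h],
and each average is within M h^α of the endpoint value. -/
theorem abs_regInt_one_sub_le {α M : ℝ} (hα : 0 < α) {g : ℝ → ℝ}
    (hg : ∀ s t, |g t - g s| ≤ M * |t - s| ^ α) (u v : ℝ) {h : ℝ} (hh : 0 < h) :
    |regInt (fun _ => 1) g h u v - (g v - g u)| ≤ 2 * (M * h ^ α) := by
  have hc := continuous_of_holder hα hg
  have hi : ∀ a b, IntervalIntegrable g volume a b := fun a b => hc.intervalIntegrable _ _
  have key : ∀ x, |h⁻¹ * (∫ s in x..x + h, g s) - g x| ≤ M * h ^ α := by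
    intro x
    have e : h⁻¹ * (∫ s in x..x + h, g s) - g x = h⁻¹ * ∫ s in x..x + h, (g s - g x) := by
      rw [intervalIntegral.integral_sub (hi _ _) (by simp)]
      simp only [intervalIntegral.integral_const, add_sub_cancel_left, smul_eq_mul]
      field_simp
    have hb : ‖∫ s in x..x + h, (g s - g x)‖ ≤ M * h ^ α * |x + h - x| := by
      refine intervalIntegral.norm_integral_le_of_norm_le_const fun s hs => ?_
      rw [uIoc_of_le (by linarith)] at hs
      refine (hg x s).trans ?_
      have hM : 0 ≤ M := by
        have := (abs_nonneg _).trans (hg 0 1)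
        simpa using this
      have : |s - x| ≤ h := by rw [abs_of_pos (by linarith [hs.1])]; linarith [hs.2]
      gcongr
    rw [e, abs_mul, abs_of_pos (inv_pos.2 hh)]
    rw [Real.norm_eq_abs, add_sub_cancel_left, abs_of_pos hh] at hb
    calc h⁻¹ * _ ≤ h⁻¹ * (M * h ^ α * h) := by gcongr
      _ = _ := by field_simp
  have e : regInt (fun _ => 1) g h u v =
      h⁻¹ * (∫ s in v..v + h, g s) - h⁻¹ * (∫ s in u..u + h, g s) := by
    unfold regInt
    rw [← mul_sub]
    congr 1
    simp only [one_mul]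
    rw [intervalIntegral.integral_sub
      (Continuous.intervalIntegrable (by fun_prop) _ _) (hi _ _),
      intervalIntegral.integral_comp_add_right (fun s => g s)]
    have h1 := intervalIntegral.integral_add_adjacent_intervals (hi u v) (hi v (v + h))
    have h2 := intervalIntegral.integral_add_adjacent_intervals (hi u (u + h)) (hi (u + h) (v + h))
    linarith
  rw [e]
  have h1 := abs_le.1 (key u)
  have h2 := abs_le.1 (key v)
  rw [abs_le]
  constructor <;> linarith [h1.1, h1.2, h2.1, h2.2]

/-- An increment of g over 2k splits into two over k. Translating the later one by k moves the shift
onto φ, so the main term is a product of two increments, and the translated domain leaves two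
boundary integrals. -/
theorem regInt_halve_eq {φ g : ℝ → ℝ} (hφ : Continuous φ) (hg : Continuous g) (u v : ℝ) {k : ℝ}
    (hk : 0 < k) :
    regInt φ g (2 * k) u v - regInt φ g k u v =
      (2 * k)⁻¹ * ((∫ s in u..v, (φ (s - k) - φ s) * (g (s + k) - g s)) +
        (∫ s in v..v + k, φ (s - k) * (g (s + k) - g s)) -
        ∫ s in u..u + k, φ (s - k) * (g (s + k) - g s)) := by
  unfold regInt
  have e1 : (∫ s in u..v, φ s * (g (s + 2 * k) - g s)) =
      (∫ s in u..v, φ s * (g (s + k + k) - g (s + k))) + ∫ s in u..v, φ s * (g (s + k) - g s) := by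
    rw [← intervalIntegral.integral_add (Continuous.intervalIntegrable (by fun_prop) _ _)
      (Continuous.intervalIntegrable (by fun_prop) _ _)]
    congr 1
    ext s
    rw [show s + 2 * k = s + k + k by ring]
    ring
  have e2 : (∫ s in u..v, φ s * (g (s + k + k) - g (s + k))) =
      ∫ s in u + k..v + k, φ (s - k) * (g (s + k) - g s) := by
    rw [← intervalIntegral.integral_comp_add_right (fun s => φ (s - k) * (g (s + k) - g s))]
    simp
  have hi : ∀ a b, IntervalIntegrable (fun s => φ (s - k) * (g (s + k) - g s)) volume a b :=
    fun a b => Continuous.intervalIntegrable (by fun_prop) _ _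
  have h1 := intervalIntegral.integral_add_adjacent_intervals (hi u v) (hi v (v + k))
  have h2 := intervalIntegral.integral_add_adjacent_intervals (hi u (u + k)) (hi (u + k) (v + k))
  have e3 : (∫ s in u..v, (φ (s - k) - φ s) * (g (s + k) - g s)) =
      (∫ s in u..v, φ (s - k) * (g (s + k) - g s)) - ∫ s in u..v, φ s * (g (s + k) - g s) := by
    rw [← intervalIntegral.integral_sub (hi _ _) (Continuous.intervalIntegrable (by fun_prop) _ _)]
    congr 1
    ext s
    ring
  rw [e1, e2, e3]
  field_simp
  linarith

/-- A product of two α-Hölder increments divided by k gives k^(2α-1), summable over dyadic k because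
2α > 1. Subtracting `f u` keeps the boundary terms of order (v-u)^α instead of sup |f|. -/
theorem regInt_halve_le {α R M : ℝ} (hα : 0 < α) (hR : 0 ≤ R) (hM : 0 ≤ M) {f g : ℝ → ℝ}
    (hf : ∀ s t, |f t - f s| ≤ R * |t - s| ^ α) (hg : ∀ s t, |g t - g s| ≤ M * |t - s| ^ α)
    {u v k : ℝ} (hk : 0 < k) (hkv : k ≤ v - u) :
    |regInt (fun s => f s - f u) g (2 * k) u v - regInt (fun s => f s - f u) g k u v| ≤
      R * M * ((v - u) * k ^ (2 * α - 1) + (v - u) ^ α * k ^ α) := by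
  have hfc := continuous_of_holder hα hf
  have hgc := continuous_of_holder hα hg
  have hu : 0 ≤ v - u := hk.le.trans hkv
  rw [regInt_halve_eq (by fun_prop) hgc u v hk]
  have hgk : ∀ s, |g (s + k) - g s| ≤ M * k ^ α := fun s => by
    simpa [abs_of_pos hk] using hg s (s + k)
  have b1 : |∫ s in u..v, ((f (s - k) - f u) - (f s - f u)) * (g (s + k) - g s)| ≤
      R * k ^ α * (M * k ^ α) * (v - u) := by
    have := intervalIntegral.norm_integral_le_of_norm_le_const (a := u) (b := v)
      (f := fun s => ((f (s - k) - f u) - (f s - f u)) * (g (s + k) - g s))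
      (C := R * k ^ α * (M * k ^ α)) (fun s _ => by
        rw [Real.norm_eq_abs, abs_mul]
        have : |f (s - k) - f u - (f s - f u)| ≤ R * k ^ α := by
          simpa [abs_of_pos hk] using hf s (s - k)
        have := hgk s
        gcongr)
    rwa [abs_of_nonneg hu] at this
  have b2 : ∀ x, (x = u ∨ x = v) → |∫ s in x..x + k, (f (s - k) - f u) * (g (s + k) - g s)| ≤
      R * (v - u) ^ α * (M * k ^ α) * k := by
    intro x hx
    have := intervalIntegral.norm_integral_le_of_norm_le_const (a := x) (b := x + k)
      (f := fun s => (f (s - k) - f u) * (g (s + k) - g s))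
      (C := R * (v - u) ^ α * (M * k ^ α)) (fun s hs => by
        rw [Real.norm_eq_abs, abs_mul]
        rw [uIoc_of_le (by linarith)] at hs
        have h1 : |f (s - k) - f u| ≤ R * (v - u) ^ α := by
          refine (hf _ _).trans ?_
          have : |s - k - u| ≤ v - u := by
            rw [abs_le]
            rcases hx with rfl | rfl <;> constructor <;> linarith [hs.1, hs.2]
          gcongr
        have := hgk s
        gcongr)
    rwa [add_sub_cancel_left, abs_of_pos hk] at this
  have b3 := b2 u (Or.inl rfl)
  have b4 := b2 v (Or.inr rfl)
  rw [abs_mul, abs_of_pos (by positivity : 0 < (2 * k)⁻¹)]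
  have hkk : k ^ (2 * α - 1) = k ^ α * k ^ α / k := by
    rw [← Real.rpow_add hk, Real.rpow_sub_one hk.ne']; congr 2; ring
  calc _ ≤ (2 * k)⁻¹ * (R * k ^ α * (M * k ^ α) * (v - u) +
        R * (v - u) ^ α * (M * k ^ α) * k + R * (v - u) ^ α * (M * k ^ α) * k) := by
        gcongr
        refine (abs_sub _ _).trans ?_
        refine add_le_add ((abs_add_le _ _).trans (add_le_add b1 b4)) b3
    _ = R * M * ((v - u) * k ^ (2 * α - 1) / 2 + (v - u) ^ α * k ^ α) := by
        rw [hkk]; field_simp; ring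
    _ ≤ _ := by
        gcongr
        have : 0 ≤ (v - u) * k ^ (2 * α - 1) := by positivity
        linarith

/-- Telescoping over dyadic scales: the halving errors form a geometric series of ratio 2^(-(2α-1)),
which gives both convergence and the Young–Loève bound. -/
theorem exists_regInt_tendsto {α : ℝ} (hα : 1 / 2 < α) (hα1 : α ≤ 1) : ∃ C : ℝ, 0 < C ∧
    ∀ (R M : ℝ) (f g : ℝ → ℝ), 0 ≤ R → 0 ≤ M → (∀ s t, |f t - f s| ≤ R * |t - s| ^ α) →
    (∀ s t, |g t - g s| ≤ M * |t - s| ^ α) → ∀ u v : ℝ, u ≤ v → v ≤ u + 1 →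
    ∃ J, Tendsto (fun n : ℕ => regInt f g ((1 / 2) ^ n) u v) atTop (𝓝 J) ∧
      |J - f u * (g v - g u)| ≤ C * (R * M) * (v - u) ^ (2 * α) := by
  set r : ℝ := (1 / 2 : ℝ) ^ (2 * α - 1) with hr
  have hr0 : 0 < r := by positivity
  have hr1 : r < 1 := Real.rpow_lt_one (by norm_num) (by norm_num) (by linarith)
  have hpos : 0 < 1 - r := by linarith
  refine ⟨2 + 2 / (1 - r), by positivity, ?_⟩
  intro R M f g hR hM hf hg u v huv hv1
  have hα0 : 0 < α := by linarith
  have hfc := continuous_of_holder hα0 hf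
  have hgc := continuous_of_holder hα0 hg
  rcases huv.eq_or_lt with rfl | huv
  · refine ⟨0, by simp [regInt], ?_⟩
    simp [Real.zero_rpow (by linarith : (2 * α) ≠ 0)]
  have hd : 0 < v - u := by linarith
  -- The starting scale 2^(-n₀) is comparable with v - u, so every halved step k is at most v - u.
  obtain ⟨n₀, h1, h2⟩ := exists_nat_pow_near_of_lt_one hd (by linarith : v - u ≤ 1)
    (by norm_num : (0 : ℝ) < 1 / 2) (by norm_num)
  set φ : ℝ → ℝ := fun s => f s - f u with hφ
  set S : ℕ → ℝ := fun j => regInt φ g ((1 / 2) ^ (n₀ + j)) u v with hS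
  have hstep : ∀ j, dist (S j) (S (j + 1)) ≤ 2 * (R * M) * (v - u) ^ (2 * α) * r ^ j := by
    intro j
    have hk : (0 : ℝ) < (1 / 2) ^ (n₀ + (j + 1)) := by positivity
    have hk1 : (1 / 2 : ℝ) ^ (n₀ + (j + 1)) ≤ (v - u) * (1 / 2) ^ j := by
      rw [show n₀ + (j + 1) = (n₀ + 1) + j by ring, pow_add]
      have := h1.le
      gcongr
    have hkv : (1 / 2 : ℝ) ^ (n₀ + (j + 1)) ≤ v - u :=
      hk1.trans (mul_le_of_le_one_right hd.le (pow_le_one₀ (by norm_num) (by norm_num)))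
    have := regInt_halve_le hα0 hR hM hf hg hk hkv
    have e : (2 : ℝ) * (1 / 2) ^ (n₀ + (j + 1)) = (1 / 2) ^ (n₀ + j) := by
      rw [← add_assoc, pow_succ]; ring
    rw [e] at this
    rw [Real.dist_eq]
    refine this.trans ?_
    have i1 : ((1 / 2 : ℝ) ^ (n₀ + (j + 1))) ^ (2 * α - 1) ≤ (v - u) ^ (2 * α - 1) * r ^ j := by
      calc _ ≤ ((v - u) * (1 / 2) ^ j) ^ (2 * α - 1) :=
            Real.rpow_le_rpow hk.le hk1 (by linarith)
        _ = _ := by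
            rw [Real.mul_rpow hd.le (by positivity), hr, ← Real.rpow_natCast, ← Real.rpow_natCast,
              ← Real.rpow_mul (by norm_num), ← Real.rpow_mul (by norm_num), mul_comm (j : ℝ)]
    have i2 : ((1 / 2 : ℝ) ^ (n₀ + (j + 1))) ^ α ≤ (v - u) ^ α * r ^ j := by
      calc _ ≤ ((v - u) * (1 / 2) ^ j) ^ α := Real.rpow_le_rpow hk.le hk1 (by linarith)
        _ = (v - u) ^ α * (((1 / 2) ^ j) ^ α) := Real.mul_rpow hd.le (by positivity)
        -- Since α ≤ 1, α ≥ 2α - 1, so the boundary terms decay at least at the rate `r`.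
        _ ≤ (v - u) ^ α * (((1 / 2) ^ j) ^ (2 * α - 1)) := by
            gcongr ?_ * ?_
            exact Real.rpow_le_rpow_of_exponent_ge (by positivity)
              (pow_le_one₀ (by norm_num) (by norm_num)) (by linarith)
        _ = _ := by
            rw [hr, ← Real.rpow_natCast, ← Real.rpow_natCast,
              ← Real.rpow_mul (by norm_num), ← Real.rpow_mul (by norm_num), mul_comm (j : ℝ)]
    have e1 : (v - u) * ((v - u) ^ (2 * α - 1) * r ^ j) = (v - u) ^ (2 * α) * r ^ j := by
      rw [Real.rpow_sub_one hd.ne']; field_simp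
    have e2 : (v - u) ^ α * ((v - u) ^ α * r ^ j) = (v - u) ^ (2 * α) * r ^ j := by
      rw [two_mul, Real.rpow_add hd]; ring
    calc _ ≤ R * M * ((v - u) * ((v - u) ^ (2 * α - 1) * r ^ j)
          + (v - u) ^ α * ((v - u) ^ α * r ^ j)) := by gcongr
      _ = _ := by rw [e1, e2]; ring
  obtain ⟨J, hJ⟩ := cauchySeq_tendsto_of_complete (cauchySeq_of_le_geometric _ _ hr1 hstep)
  have hdist := dist_le_of_le_geometric_of_tendsto₀ _ _ hr1 hstep hJ
  -- At the starting scale the crude bound suffices: h lies between v - u and 2(v - u), so the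
  -- length of the interval cancels the factor 1/h.
  have hS0 : |S 0| ≤ 2 * (R * M) * (v - u) ^ (2 * α) := by
    have hh : (0 : ℝ) < (1 / 2) ^ n₀ := by positivity
    have hle : (1 / 2 : ℝ) ^ n₀ ≤ 2 * (v - u) := by rw [pow_succ] at h1; linarith
    have hb := intervalIntegral.norm_integral_le_of_norm_le_const (a := u) (b := v)
      (f := fun s => φ s * (g (s + (1 / 2) ^ n₀) - g s))
      (C := R * (v - u) ^ α * (M * ((1 / 2) ^ n₀) ^ α)) (fun s hs => by
        rw [uIoc_of_le huv.le] at hs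
        rw [Real.norm_eq_abs, abs_mul]
        have i1 : |φ s| ≤ R * (v - u) ^ α := by
          refine (hf u s).trans ?_
          have : |s - u| ≤ v - u := by rw [abs_of_pos (by linarith [hs.1])]; linarith [hs.2]
          gcongr
        have i2 : |g (s + (1 / 2) ^ n₀) - g s| ≤ M * ((1 / 2) ^ n₀) ^ α := by
          simpa [abs_of_pos hh] using hg s (s + (1 / 2) ^ n₀)
        gcongr)
    rw [abs_of_pos hd, Real.norm_eq_abs] at hb
    simp only [hS, regInt, add_zero]
    rw [abs_mul, abs_of_pos (inv_pos.2 hh)]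
    calc _ ≤ ((1 / 2 : ℝ) ^ n₀)⁻¹ * (R * (v - u) ^ α * (M * ((1 / 2) ^ n₀) ^ α) * (v - u)) := by
          gcongr
      _ ≤ ((1 / 2 : ℝ) ^ n₀)⁻¹ *
            (R * (v - u) ^ α * (M * (2 * (v - u) ^ α)) * (1 / 2 : ℝ) ^ n₀) := by
          gcongr
          calc ((1 / 2 : ℝ) ^ n₀) ^ α ≤ (2 * (v - u)) ^ α := by gcongr
            _ = 2 ^ α * (v - u) ^ α := Real.mul_rpow (by norm_num) hd.le
            _ ≤ 2 ^ (1 : ℝ) * (v - u) ^ α := by gcongr; norm_num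
            _ = _ := by rw [Real.rpow_one]
      _ = 2 * (R * M) * ((v - u) ^ α * (v - u) ^ α) := by field_simp
      _ = _ := by rw [← Real.rpow_add hd, ← two_mul]
  have hJ' : |J| ≤ (2 + 2 / (1 - r)) * (R * M) * (v - u) ^ (2 * α) := by
    rw [Real.dist_eq] at hdist
    have := abs_sub_abs_le_abs_sub J (S 0)
    rw [abs_sub_comm J] at this
    calc |J| ≤ |S 0| + |S 0 - J| := by linarith
      _ ≤ 2 * (R * M) * (v - u) ^ (2 * α) + 2 * (R * M) * (v - u) ^ (2 * α) / (1 - r) := by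
          gcongr
      _ = _ := by ring
  refine ⟨J + f u * (g v - g u), ?_, by simpa using hJ'⟩
  have hJ2 : Tendsto (fun n : ℕ => regInt φ g ((1 / 2) ^ n) u v) atTop (𝓝 J) := by
    rw [← tendsto_add_atTop_iff_nat n₀]
    refine hJ.congr fun j => ?_
    simp only [hS, add_comm]
  have hone : Tendsto (fun n : ℕ => regInt (fun _ => 1) g ((1 / 2) ^ n) u v) atTop
      (𝓝 (g v - g u)) := by
    rw [tendsto_iff_dist_tendsto_zero]
    refine squeeze_zero (fun _ => dist_nonneg)
      (fun n => abs_regInt_one_sub_le hα0 hg u v (by positivity : (0 : ℝ) < (1 / 2) ^ n)) ?_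
    have h0 : Tendsto (fun n : ℕ => ((1 / 2 : ℝ) ^ n) ^ α) atTop (𝓝 0) := by
      have := (tendsto_pow_atTop_nhds_zero_of_lt_one (by norm_num : (0 : ℝ) ≤ 1 / 2)
        (by norm_num)).rpow_const (p := α) (Or.inr hα0.le)
      rwa [Real.zero_rpow hα0.ne'] at this
    simpa using (h0.const_mul M).const_mul 2
  refine (hJ2.add (hone.const_mul (f u))).congr fun n => ?_
  simp only [regInt, hφ]
  rw [mul_left_comm, ← mul_add, ← intervalIntegral.integral_const_mul,
    ← intervalIntegral.integral_add (Continuous.intervalIntegrable (by fun_prop) _ _)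
      (Continuous.intervalIntegrable (by fun_prop) _ _)]
  congr 2
  ext s
  ring

/-- A uniform partition fine enough for both limits compares them. This pins down the value chosen
in `youngIntegral`. -/
theorem HasYoungIntegral.unique {f g : ℝ → ℝ} {u v I J : ℝ} (huv : u ≤ v)
    (hI : HasYoungIntegral f g u v I) (hJ : HasYoungIntegral f g u v J) : I = J := by
  by_contra hne
  have he : 0 < |I - J| / 2 := by
    have := abs_pos.2 (sub_ne_zero.2 hne); positivity
  obtain ⟨δ₁, hδ₁, h₁⟩ := hI _ he
  obtain ⟨δ₂, hδ₂, h₂⟩ := hJ _ he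
  obtain ⟨n, hn⟩ := exists_nat_gt ((v - u) / min δ₁ δ₂)
  have hmin : 0 < min δ₁ δ₂ := lt_min hδ₁ hδ₂
  have hn0 : (0 : ℝ) < n := lt_of_le_of_lt (by apply div_nonneg <;> linarith) hn
  have hstep : (v - u) / n < min δ₁ δ₂ := by
    rw [div_lt_iff₀ hmin] at hn
    rw [div_lt_iff₀ hn0]; linarith
  set t : ℕ → ℝ := fun k => u + k * ((v - u) / n) with ht
  have hnn : 0 ≤ (v - u) / n := div_nonneg (by linarith) hn0.le
  have hmono : Monotone t := fun a b hab => by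
    simp only [ht]
    have : (a : ℝ) ≤ b := by exact_mod_cast hab
    gcongr
  have hd : ∀ k, t (k + 1) - t k = (v - u) / n := fun k => by simp only [ht]; push_cast; ring
  have hl : ∀ k < n, t k ∈ Icc (t k) (t (k + 1)) := fun k _ => ⟨le_rfl, hmono (Nat.le_succ k)⟩
  have ht0 : t 0 = u := by simp [ht]
  have htn : t n = v := by simp only [ht]; field_simp; ring
  have a₁ := h₁ n t t hmono ht0 htn
    (fun k _ => by rw [hd]; exact hstep.trans_le (min_le_left _ _)) hl
  have a₂ := h₂ n t t hmono ht0 htn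
    (fun k _ => by rw [hd]; exact hstep.trans_le (min_le_right _ _)) hl
  rw [abs_sub_comm] at a₁
  have := abs_sub_le I (∑ k ∈ Finset.range n, f (t k) * (g (t (k + 1)) - g (t k))) J
  linarith

/-- An additive functional that is locally close to `f(u) (g(v) - g(u))` is the Young integral. -/
theorem hasYoungIntegral_of_local {α R M D : ℝ} (hα : 1 / 2 < α) (hR : 0 ≤ R) (hM : 0 ≤ M)
    (hD : 0 ≤ D) {f g F : ℝ → ℝ}
    (hf : HolderBdd α R f) (hg : HolderBdd α M g)
    (hF : ∀ u ∈ Icc (0 : ℝ) 1, ∀ v ∈ Icc (0 : ℝ) 1, u ≤ v →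
      |F v - F u - f u * (g v - g u)| ≤ D * (v - u) ^ (2 * α)) {T : ℝ} (hT : T ∈ Icc (0 : ℝ) 1) :
    HasYoungIntegral f g 0 T (F T - F 0) := by
  intro ε hε
  set c := R * M + D with hc
  have hc0 : 0 ≤ c := by positivity
  -- A cell of length d contributes an error c d^(2α) ≤ c δ^(2α-1) d, and the lengths sum to at most
  -- 1. The denominator c + 1 avoids division by zero and yields a strict inequality.
  set δ : ℝ := (ε / (c + 1)) ^ (1 / (2 * α - 1)) with hδ
  have hδ0 : 0 < δ := by positivity
  have hδe : δ ^ (2 * α - 1) = ε / (c + 1) := by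
    rw [hδ, ← Real.rpow_mul (by positivity), one_div, inv_mul_cancel₀ (by linarith), Real.rpow_one]
  refine ⟨δ, hδ0, fun n t ξ hmono h0 hn hmesh hξ => ?_⟩
  have hmem : ∀ k ≤ n, t k ∈ Icc (0 : ℝ) 1 := fun k hk =>
    ⟨h0 ▸ hmono (Nat.zero_le k), (hmono hk).trans (hn ▸ hT.2)⟩
  have hterm : ∀ k ∈ Finset.range n, |f (ξ k) * (g (t (k + 1)) - g (t k)) -
      (F (t (k + 1)) - F (t k))| ≤ c * (ε / (c + 1)) * (t (k + 1) - t k) := by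
    intro k hk
    have hk' := Finset.mem_range.1 hk
    have m1 := hmem k hk'.le
    have m2 := hmem (k + 1) hk'
    have hle : t k ≤ t (k + 1) := hmono (Nat.le_succ k)
    have hx := hξ k hk'
    have mξ : ξ k ∈ Icc (0 : ℝ) 1 := ⟨m1.1.trans hx.1, hx.2.trans m2.2⟩
    set d := t (k + 1) - t k with hd
    have hd0 : 0 ≤ d := by linarith
    have b1 : |f (ξ k) - f (t k)| ≤ R * d ^ α := by
      refine (hf _ m1 _ mξ).trans ?_
      have : |ξ k - t k| ≤ d := by rw [abs_of_nonneg (by linarith [hx.1])]; linarith [hx.2]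
      gcongr
    have b2 : |g (t (k + 1)) - g (t k)| ≤ M * d ^ α := by
      simpa [abs_of_nonneg hd0, ← hd] using hg _ m1 _ m2
    have b3 := hF _ m1 _ m2 hle
    have hdd : d ^ α * d ^ α = d ^ (2 * α) := by
      rw [← Real.rpow_add_of_nonneg hd0 (by linarith) (by linarith), two_mul]
    have hd2 : d ^ (2 * α) ≤ (ε / (c + 1)) * d := by
      have : d ^ (2 * α) = d ^ (2 * α - 1) * d := by
        conv_lhs => rw [show 2 * α = (2 * α - 1) + 1 by ring]
        rw [Real.rpow_add_of_nonneg hd0 (by linarith) (by linarith), Real.rpow_one]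
      rw [this, ← hδe]
      have := (hmesh k hk').le
      have : d ^ (2 * α - 1) ≤ δ ^ (2 * α - 1) := Real.rpow_le_rpow hd0 this (by linarith)
      gcongr
    calc _ = |(f (ξ k) - f (t k)) * (g (t (k + 1)) - g (t k)) -
          (F (t (k + 1)) - F (t k) - f (t k) * (g (t (k + 1)) - g (t k)))| := by congr 1; ring
      _ ≤ |f (ξ k) - f (t k)| * |g (t (k + 1)) - g (t k)| + D * d ^ (2 * α) := by
          refine (abs_sub _ _).trans ?_
          rw [abs_mul]; gcongr
      _ ≤ R * d ^ α * (M * d ^ α) + D * d ^ (2 * α) := by gcongr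
      _ = c * d ^ (2 * α) := by rw [hc, ← hdd]; ring
      _ ≤ c * ((ε / (c + 1)) * d) := by gcongr
      _ = _ := by ring
  have hsum : F T - F 0 = ∑ k ∈ Finset.range n, (F (t (k + 1)) - F (t k)) := by
    rw [Finset.sum_range_sub (fun k => F (t k)), h0, hn]
  rw [hsum, ← Finset.sum_sub_distrib]
  calc _ ≤ ∑ k ∈ Finset.range n, c * (ε / (c + 1)) * (t (k + 1) - t k) :=
        (Finset.abs_sum_le_sum_abs _ _).trans (Finset.sum_le_sum hterm)
    _ = c * (ε / (c + 1)) * T := by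
        rw [← Finset.mul_sum, Finset.sum_range_sub, h0, hn, sub_zero]
    _ ≤ c * (ε / (c + 1)) * 1 := by gcongr; exact hT.2
    _ = ε * (c / (c + 1)) := by ring
    _ < ε := by
        have : c / (c + 1) < 1 := by rw [div_lt_one (by linarith)]; linarith
        nlinarith

/-- Existence of the Young integral, and the Young–Loève estimate. -/
theorem young_loeve {α : ℝ} (hα : 1 / 2 < α) (hα1 : α ≤ 1) : ∃ C : ℝ, 0 < C ∧
    ∀ (R M : ℝ) (f g : ℝ → ℝ), HolderBdd α R f → HolderBdd α M g →
    (∀ t ∈ Icc (0 : ℝ) 1, ∃ J, HasYoungIntegral f g 0 t J) ∧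
    ∀ u ∈ Icc (0 : ℝ) 1, ∀ v ∈ Icc (0 : ℝ) 1, u ≤ v →
      |youngIntegral f g 0 v - youngIntegral f g 0 u - f u * (g v - g u)| ≤
        C * (R * M) * (v - u) ^ (2 * α) := by
  obtain ⟨C, hC, hmain⟩ := exists_regInt_tendsto hα hα1
  refine ⟨C, hC, fun R M f g hf hg => ?_⟩
  have hnn : ∀ {L : ℝ} {φ : ℝ → ℝ}, HolderBdd α L φ → 0 ≤ L := fun {L φ} h => by
    have := (abs_nonneg _).trans (h 0 ⟨le_rfl, zero_le_one⟩ 1 ⟨zero_le_one, le_rfl⟩)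
    simpa using this
  have hR := hnn hf
  have hM := hnn hg
  -- Clamping to [0,1] is 1-Lipschitz, so it preserves the Hölder bounds while giving meaning to the
  -- shifted arguments that leave [0,1].
  set c : ℝ → ℝ := fun x => (projIcc (0 : ℝ) 1 zero_le_one x : ℝ) with hcdef
  have hc : ∀ x ∈ Icc (0 : ℝ) 1, c x = x := fun x hx => by simp [hcdef, projIcc_of_mem _ hx]
  have hcm : ∀ x, c x ∈ Icc (0 : ℝ) 1 := fun x => (projIcc (0 : ℝ) 1 zero_le_one x).2
  have hext : ∀ {L : ℝ} {φ : ℝ → ℝ}, HolderBdd α L φ →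
      ∀ s t, |φ (c t) - φ (c s)| ≤ L * |t - s| ^ α := fun {L φ} h s t => by
    refine (h _ (hcm s) _ (hcm t)).trans ?_
    have := hnn h
    have h2 : |c t - c s| ≤ |t - s| := abs_projIcc_sub_projIcc zero_le_one
    gcongr
  have hf' := hext hf
  have hg' := hext hg
  have hα0 : 0 < α := by linarith
  have hfc := continuous_of_holder hα0 hf'
  have hgc := continuous_of_holder hα0 hg'
  have key := hmain R M (fun x => f (c x)) (fun x => g (c x)) hR hM hf' hg'
  have hex : ∀ t : ℝ, ∃ J, t ∈ Icc (0 : ℝ) 1 →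
      Tendsto (fun n : ℕ => regInt (fun x => f (c x)) (fun x => g (c x)) ((1 / 2) ^ n) 0 t)
        atTop (𝓝 J) := by
    intro t
    by_cases ht : t ∈ Icc (0 : ℝ) 1
    · obtain ⟨J, hJ, -⟩ := key 0 t ht.1 (by linarith [ht.2])
      exact ⟨J, fun _ => hJ⟩
    · exact ⟨0, fun h => absurd h ht⟩
  choose F hFt using hex
  have hF : ∀ u ∈ Icc (0 : ℝ) 1, ∀ v ∈ Icc (0 : ℝ) 1, u ≤ v →
      |F v - F u - f u * (g v - g u)| ≤ C * (R * M) * (v - u) ^ (2 * α) := by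
    intro u hu v hv huv
    obtain ⟨J, hJ, hJb⟩ := key u v huv (by linarith [hu.1, hv.2])
    -- Additivity of the regularised integrals passes to the limit and identifies `J` with `F v - F
    -- u`.
    have h1 := (hFt u hu).add hJ
    have h2 : F u + J = F v :=
      tendsto_nhds_unique (h1.congr fun n => regInt_add hfc hgc _ _ _ _) (hFt v hv)
    simp only [hc u hu, hc v hv] at hJb
    rwa [← h2, add_sub_cancel_left]
  have hY : ∀ t ∈ Icc (0 : ℝ) 1, HasYoungIntegral f g 0 t (F t - F 0) := fun t ht =>
    hasYoungIntegral_of_local hα hR hM (by positivity) hf hg hF ht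
  have hYI : ∀ t ∈ Icc (0 : ℝ) 1, youngIntegral f g 0 t = F t - F 0 := fun t ht => by
    have hx : ∃ I, HasYoungIntegral f g 0 t I := ⟨_, hY t ht⟩
    rw [youngIntegral, dif_pos hx]
    exact hx.choose_spec.unique ht.1 (hY t ht)
  refine ⟨fun t ht => ⟨_, hY t ht⟩, fun u hu v hv huv => ?_⟩
  rw [hYI u hu, hYI v hv, sub_sub_sub_cancel_right]
  exact hF u hu v hv huv

/-! ### Small balls from characteristic functions -/

theorem integral_exp_neg_sq_gaussianReal_le {a : ℝ} (ha : 0 < a) :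
    ∫ x, Real.exp (-(a / 2) * x ^ 2) ∂(gaussianReal 0 1) ≤ (√a)⁻¹ := by
  rw [integral_gaussianReal_eq_integral_smul (by norm_num)]
  have hI : Integrable (fun x : ℝ => (√(2 * Real.pi))⁻¹ * Real.exp (-(a / 2) * x ^ 2)) :=
    (integrable_exp_neg_mul_sq (by positivity)).const_mul _
  have h1 : ∫ x, gaussianPDFReal 0 1 x • Real.exp (-(a / 2) * x ^ 2) ≤
      ∫ x, (√(2 * Real.pi))⁻¹ * Real.exp (-(a / 2) * x ^ 2) := by
    refine integral_mono_of_nonneg (ae_of_all _ fun x => ?_) hI (ae_of_all _ fun x => ?_)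
    · have := gaussianPDFReal_nonneg 0 1 x
      simp only [smul_eq_mul, Pi.zero_apply]
      positivity
    · simp only [smul_eq_mul, gaussianPDFReal, NNReal.coe_one, mul_one, sub_zero]
      gcongr
      -- The factor exp(-x²/2) of the normal density is simply dropped.
      refine mul_le_of_le_one_right (by positivity) (Real.exp_le_one_iff.2 ?_)
      have := sq_nonneg x
      linarith
  refine h1.trans (le_of_eq ?_)
  rw [integral_const_mul, integral_gaussian, ← Real.sqrt_inv, ← Real.sqrt_inv,
    ← Real.sqrt_mul (by positivity)]
  congr 1
  field_simp

/-- Small ball estimate for random vectors whose characteristic function is dominated by that of a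
nondegenerate Gaussian vector. -/
theorem smallBall_of_charFun_le {Ω : Type*} [MeasurableSpace Ω] (P : Measure Ω)
    [IsProbabilityMeasure P] {K : ℕ} (Z : Fin K → Ω → ℝ) (hZ : ∀ j, Measurable (Z j)) {σ η : ℝ}
    (hσ : 0 < σ) (hη : 0 < η)
    (hchar : ∀ u : Fin K → ℝ, ‖∫ ω, Complex.exp ((∑ j, u j * Z j ω : ℝ) * Complex.I) ∂P‖ ≤
      Real.exp (-(σ ^ 2 / 2) * ∑ j, u j ^ 2)) :
    P {ω | ∀ j, |Z j ω| ≤ η} ≤ ENNReal.ofReal ((2 * (η / σ)) ^ K) := by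
  classical
  set π : Measure (Fin K → ℝ) := Measure.pi fun _ => gaussianReal 0 1 with hπ
  -- A smooth substitute for the indicator of the ball. It is the characteristic function of a
  -- standard Gaussian vector at Z/η, so Fubini turns its mean into a Gaussian average of
  -- characteristic functions of Z.
  set Φ : Ω → ℝ := fun ω => Real.exp (-(∑ j, (Z j ω / η) ^ 2) / 2) with hΦ
  have hΦm : Measurable Φ := by fun_prop
  have hgauss : ∀ w : Fin K → ℝ,
      ∫ x, Complex.exp ((∑ j, x j * w j : ℝ) * Complex.I) ∂π =
        (Real.exp (-(∑ j, w j ^ 2) / 2) : ℝ) := by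
    intro w
    have e : ∀ x : Fin K → ℝ, Complex.exp ((∑ j, x j * w j : ℝ) * Complex.I) =
        ∏ j, Complex.exp ((w j : ℂ) * (x j : ℂ) * Complex.I) := by
      intro x
      rw [← Complex.exp_sum]
      congr 1
      push_cast
      rw [Finset.sum_mul]
      refine Finset.sum_congr rfl fun j _ => by ring
    simp_rw [e]
    rw [hπ, integral_fintype_prod_eq_prod (𝕜 := ℂ)
      (fun j (x : ℝ) => Complex.exp ((w j : ℂ) * (x : ℂ) * Complex.I))]
    simp_rw [← charFun_apply_real, charFun_gaussianReal]
    rw [← Complex.exp_sum]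
    push_cast
    congr 1
    rw [neg_div, Finset.sum_div, ← Finset.sum_neg_distrib]
    refine Finset.sum_congr rfl fun j _ => by simp
  have hswap : ((∫ ω, Φ ω ∂P : ℝ) : ℂ) =
      ∫ x, ∫ ω, Complex.exp ((∑ j, x j * (Z j ω / η) : ℝ) * Complex.I) ∂P ∂π := by
    rw [← integral_integral_swap]
    · rw [← integral_complex_ofReal]
      refine integral_congr_ae (ae_of_all _ fun ω => ?_)
      exact (hgauss fun j => Z j ω / η).symm
    · refine Integrable.of_bound (C := 1) ?_ (ae_of_all _ fun z => ?_)
      · apply Measurable.aestronglyMeasurable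
        simp only [Function.uncurry_def]
        have : ∀ j, Measurable fun z : Ω × (Fin K → ℝ) => Z j z.1 := fun j =>
          (hZ j).comp measurable_fst
        fun_prop
      · simp only [Function.uncurry_def]
        rw [Complex.norm_exp_ofReal_mul_I]
  have hintegral : ∫ ω, Φ ω ∂P ≤ (η / σ) ^ K := by
    have hn : ∫ ω, Φ ω ∂P ≤ ‖((∫ ω, Φ ω ∂P : ℝ) : ℂ)‖ := by
      rw [Complex.norm_real]; exact le_abs_self _
    refine hn.trans ?_
    rw [hswap]
    have hprod : ∫ x : Fin K → ℝ, ∏ j, Real.exp (-((σ / η) ^ 2 / 2) * x j ^ 2) ∂π =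
        ∏ _j : Fin K, ∫ x, Real.exp (-((σ / η) ^ 2 / 2) * x ^ 2) ∂(gaussianReal 0 1) := by
      rw [hπ]
      exact integral_fintype_prod_eq_prod (𝕜 := ℝ)
        (fun j (x : ℝ) => Real.exp (-((σ / η) ^ 2 / 2) * x ^ 2))
    calc _ ≤ ∫ x : Fin K → ℝ, ∏ j, Real.exp (-((σ / η) ^ 2 / 2) * x j ^ 2) ∂π := by
          refine norm_integral_le_of_norm_le ?_ (ae_of_all _ fun x => ?_)
          · refine Integrable.of_bound (C := 1) ?_ (ae_of_all _ fun z => ?_)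
            · exact Measurable.aestronglyMeasurable (by fun_prop)
            · rw [← Real.exp_sum, Real.norm_eq_abs, Real.abs_exp, Real.exp_le_one_iff]
              refine Finset.sum_nonpos fun j _ => ?_
              have : 0 ≤ (σ / η) ^ 2 / 2 * z j ^ 2 := by positivity
              linarith
          · have h := hchar fun j => x j / η
            have e1 : ∀ ω, ∑ j, x j / η * Z j ω = ∑ j, x j * (Z j ω / η) := fun ω =>
              Finset.sum_congr rfl fun j _ => by ring
            simp_rw [e1] at h
            refine h.trans (le_of_eq ?_)
            rw [← Real.exp_sum, Finset.mul_sum]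
            congr 1
            refine Finset.sum_congr rfl fun j _ => ?_
            field_simp
      _ = ∏ _j : Fin K, ∫ x, Real.exp (-((σ / η) ^ 2 / 2) * x ^ 2) ∂(gaussianReal 0 1) := hprod
      _ ≤ ∏ _j : Fin K, (η / σ) := by
          refine Finset.prod_le_prod (fun _ _ => integral_nonneg fun x => by positivity)
            fun _ _ => ?_
          refine (integral_exp_neg_sq_gaussianReal_le (by positivity)).trans (le_of_eq ?_)
          rw [Real.sqrt_sq (by positivity), inv_div]
      _ = _ := by simp [div_pow]
  -- On the ball Φ ≥ e^(-K/2), so Markov's inequality costs only e^(K/2) ≤ 2^K.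
  have hsub : {ω | ∀ j, |Z j ω| ≤ η} ⊆ {ω | ENNReal.ofReal (Real.exp (-(K / 2 : ℝ))) ≤
      ENNReal.ofReal (Φ ω)} := by
    intro ω hω
    refine ENNReal.ofReal_le_ofReal (Real.exp_le_exp.2 ?_)
    have : ∑ j, (Z j ω / η) ^ 2 ≤ K := by
      calc _ ≤ ∑ _j : Fin K, (1 : ℝ) := by
            refine Finset.sum_le_sum fun j _ => ?_
            rw [sq_le_one_iff_abs_le_one, abs_div, abs_of_pos hη]
            exact (div_le_one hη).2 (hω j)
        _ = K := by simp
    linarith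
  have hΦI : Integrable Φ P := by
    refine Integrable.of_bound (C := 1) hΦm.aestronglyMeasurable (ae_of_all _ fun ω => ?_)
    rw [Real.norm_eq_abs, Real.abs_exp, Real.exp_le_one_iff]
    have : 0 ≤ ∑ j, (Z j ω / η) ^ 2 := Finset.sum_nonneg fun j _ => sq_nonneg _
    linarith
  refine (measure_mono hsub).trans ?_
  refine (meas_ge_le_lintegral_div hΦm.ennreal_ofReal.aemeasurable
    (by simpa using Real.exp_pos _) ENNReal.ofReal_ne_top).trans ?_
  rw [← ofReal_integral_eq_lintegral_ofReal hΦI (ae_of_all _ fun ω => (Real.exp_pos _).le),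
    ← ENNReal.ofReal_div_of_pos (Real.exp_pos _)]
  refine ENNReal.ofReal_le_ofReal ?_
  rw [div_le_iff₀ (Real.exp_pos _), mul_pow]
  have h2 : 1 ≤ (2 : ℝ) ^ K * Real.exp (-(K / 2 : ℝ)) := by
    have e : Real.exp (-(K / 2 : ℝ)) = (Real.exp (-(1 / 2))) ^ K := by
      rw [← Real.exp_nat_mul]; congr 1; ring
    rw [e, ← mul_pow]
    refine one_le_pow₀ ?_
    have := Real.add_one_le_exp (-(1 / 2) : ℝ)
    linarith
  have h3 : 0 ≤ (η / σ) ^ K := by positivity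
  calc _ ≤ (η / σ) ^ K * 1 := by rw [mul_one]; exact hintegral
    _ ≤ (η / σ) ^ K * ((2 : ℝ) ^ K * Real.exp (-(K / 2 : ℝ))) := by gcongr
    _ = _ := by ring

/-! ### Covariances and small balls for increments of type H -/

theorem hasGaussianLaw_linearCombination {Ω T ι : Type*} [Fintype ι] [MeasurableSpace Ω]
    {P : Measure Ω} {X : T → Ω → ℝ} (hX : IsGaussianProcess X P) (u : ι → ℝ) (p q : ι → T) :
    HasGaussianLaw (fun ω => ∑ j, u j * (X (q j) ω - X (p j) ω)) P := by
  classical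
  let I : Finset T := Finset.univ.image p ∪ Finset.univ.image q
  let L : (I → ℝ) →L[ℝ] ℝ := ∑ j, u j • (ContinuousLinearMap.proj (R := ℝ) (φ := fun _ : I => ℝ)
    ⟨q j, by simp [I]⟩ - ContinuousLinearMap.proj (R := ℝ) (φ := fun _ : I => ℝ)
    ⟨p j, by simp [I]⟩)
  have h := (hX.hasGaussianLaw I).map_fun L
  convert! h using 2 with ω
  simp [L, Finset.restrict_def]

theorem norm_charFun_of_centred {Ω : Type*} [MeasurableSpace Ω] {P : Measure Ω}
    [IsProbabilityMeasure P] {Y : Ω → ℝ} (hY : HasGaussianLaw Y P) (hmean : ∫ ω, Y ω ∂P = 0)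
    (w : ℝ) : ‖charFun (P.map Y) w‖ = Real.exp (-((∫ ω, Y ω ^ 2 ∂P) * w ^ 2 / 2)) := by
  have hvar : Var[Y; P] = ∫ ω, Y ω ^ 2 ∂P := by
    rw [variance_eq_integral hY.aemeasurable]
    simp [hmean]
  have h0 : 0 ≤ ∫ ω, Y ω ^ 2 ∂P := integral_nonneg fun ω => sq_nonneg _
  rw [hY.map_eq_gaussianReal, charFun_gaussianReal, Complex.norm_exp, hvar, hmean,
    Real.coe_toNNReal _ h0]
  congr 1
  simp [← Complex.ofReal_pow, ← Complex.ofReal_mul]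

/-- The mean value theorem applied twice, first in t and then in s. The intermediate point lies in
the open rectangle, where `hsep` is needed; `hne` includes the endpoints in s so that the
t-derivative is continuous on the closed interval. -/
theorem incrVar_rect_le {Ω : Type*} [MeasurableSpace Ω] {P : Measure Ω} {H : ℝ}
    {X : ℝ → Ω → ℝ} (hX : ContDiffOn ℝ 1 (fun z : ℝ × ℝ => incrVar P X z.1 z.2)
      (Ioo (0 : ℝ) 1 ×ˢ Ioo (0 : ℝ) 1)) {c₃ : ℝ} (hc₃ : 0 ≤ c₃)
    (hb : ∀ s ∈ Ioo (0 : ℝ) 1, ∀ t ∈ Ioo (0 : ℝ) 1, s ≠ t →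
      DifferentiableAt ℝ (fun s' => deriv (fun t' => incrVar P X s' t') t) s ∧
      |deriv (fun s' => deriv (fun t' => incrVar P X s' t') t) s| ≤ c₃ * |t - s| ^ (2 * H - 2))
    (hH : H < 1) {a b c d D : ℝ} (ha : 0 < a) (hab : a < b) (hb1 : b < 1) (hc : 0 < c)
    (hcd : c < d) (hd1 : d < 1) (hD : 0 < D)
    (hsep : ∀ s ∈ Ioo a b, ∀ t ∈ Ioo c d, D ≤ |t - s|)
    (hne : ∀ s ∈ Icc a b, ∀ t ∈ Ioo c d, s ≠ t) :
    |(incrVar P X b d - incrVar P X a d) - (incrVar P X b c - incrVar P X a c)| ≤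
      c₃ * D ^ (2 * H - 2) * (b - a) * (d - c) := by
  have hdiff : ∀ s ∈ Ioo (0 : ℝ) 1, ∀ t ∈ Ioo (0 : ℝ) 1,
      DifferentiableAt ℝ (fun t' => incrVar P X s t') t := by
    intro s hs t ht
    have hopen : Ioo (0 : ℝ) 1 ×ˢ Ioo (0 : ℝ) 1 ∈ 𝓝 (s, t) :=
      (isOpen_Ioo.prod isOpen_Ioo).mem_nhds ⟨hs, ht⟩
    have h1 : DifferentiableAt ℝ (fun z : ℝ × ℝ => incrVar P X z.1 z.2) (s, t) :=
      (hX.contDiffAt hopen).differentiableAt (by norm_num)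
    exact DifferentiableAt.comp (f := fun t' : ℝ => (s, t')) t h1 (by fun_prop)
  have ma : a ∈ Ioo (0 : ℝ) 1 := ⟨ha, hab.trans hb1⟩
  have mb : b ∈ Ioo (0 : ℝ) 1 := ⟨ha.trans hab, hb1⟩
  have hψ : ∀ t ∈ Icc c d, DifferentiableAt ℝ (fun t' => incrVar P X b t' - incrVar P X a t') t :=
    fun t ht => (hdiff b mb t ⟨hc.trans_le ht.1, ht.2.trans_lt hd1⟩).sub
      (hdiff a ma t ⟨hc.trans_le ht.1, ht.2.trans_lt hd1⟩)
  obtain ⟨τ, hτ, hτe⟩ := exists_deriv_eq_slope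
    (fun t' => incrVar P X b t' - incrVar P X a t') hcd
    (fun t ht => (hψ t ht).continuousAt.continuousWithinAt)
    (fun t ht => (hψ t (Ioo_subset_Icc_self ht)).differentiableWithinAt)
  have mτ : τ ∈ Ioo (0 : ℝ) 1 := ⟨hc.trans hτ.1, hτ.2.trans hd1⟩
  have hD2 : ∀ s ∈ Icc a b,
      DifferentiableAt ℝ (fun s' => deriv (fun t' => incrVar P X s' t') τ) s := fun s hs =>
    (hb s ⟨ha.trans_le hs.1, hs.2.trans_lt hb1⟩ τ mτ (hne s hs τ hτ)).1
  obtain ⟨σ, hσ, hσe⟩ := exists_deriv_eq_slope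
    (fun s' => deriv (fun t' => incrVar P X s' t') τ) hab
    (fun s hs => (hD2 s hs).continuousAt.continuousWithinAt)
    (fun s hs => (hD2 s (Ioo_subset_Icc_self hs)).differentiableWithinAt)
  have mσ : σ ∈ Ioo (0 : ℝ) 1 := ⟨ha.trans hσ.1, hσ.2.trans hb1⟩
  have hbd := (hb σ mσ τ mτ (hne σ (Ioo_subset_Icc_self hσ) τ hτ)).2
  rw [deriv_fun_sub (hdiff b mb τ mτ) (hdiff a ma τ mτ)] at hτe
  have hba : 0 < b - a := by linarith
  have hdc : 0 < d - c := by linarith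
  rw [eq_div_iff hba.ne'] at hσe
  rw [eq_div_iff hdc.ne', ← hσe] at hτe
  rw [← hτe, abs_mul, abs_mul, abs_of_pos hba, abs_of_pos hdc]
  have : |τ - σ| ^ (2 * H - 2) ≤ D ^ (2 * H - 2) :=
    Real.rpow_le_rpow_of_nonpos hD (hsep σ hσ τ hτ) (by linarith)
  gcongr
  exact hbd.trans (by gcongr)

theorem IsGaussianOfType.memLp_sub {Ω : Type*} [MeasurableSpace Ω] {P : Measure Ω} {H : ℝ}
    {X : ℝ → Ω → ℝ} (hX : IsGaussianOfType P H X) {s t : ℝ}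
    (hs : s ∈ Icc (0 : ℝ) 1) (ht : t ∈ Icc (0 : ℝ) 1) :
    MemLp (fun ω => X t ω - X s ω) 2 P :=
  (hX.gaussian.hasGaussianLaw_fun_sub (s := ⟨t, ht⟩) (t := ⟨s, hs⟩)).memLp_two

/-- Polarisation writes a product of increments as a combination of four squared increments, so
covariances are rectangular differences of `incrVar`. -/
theorem IsGaussianOfType.integral_mul_sub {Ω : Type*} [MeasurableSpace Ω] {P : Measure Ω} {H : ℝ}
    {X : ℝ → Ω → ℝ} (hX : IsGaussianOfType P H X) {a b c d : ℝ}
    (ha : a ∈ Icc (0 : ℝ) 1) (hb : b ∈ Icc (0 : ℝ) 1) (hc : c ∈ Icc (0 : ℝ) 1)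
    (hd : d ∈ Icc (0 : ℝ) 1) :
    ∫ ω, (X b ω - X a ω) * (X d ω - X c ω) ∂P =
      -(1 / 2) * ((incrVar P X b d - incrVar P X a d) - (incrVar P X b c - incrVar P X a c)) := by
  have i : ∀ {s t : ℝ}, s ∈ Icc (0 : ℝ) 1 → t ∈ Icc (0 : ℝ) 1 →
      Integrable (fun ω => (X t ω - X s ω) ^ 2) P := fun hs ht => (hX.memLp_sub hs ht).integrable_sq
  unfold incrVar
  rw [← integral_sub (i hb hd) (i ha hd), ← integral_sub (i hb hc) (i ha hc),
    ← integral_sub (by exact (i hb hd).sub (i ha hd)) (by exact (i hb hc).sub (i ha hc)),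
    ← integral_const_mul]
  congr 1
  ext ω
  ring

/-- Increments of a process of type `H` over well separated intervals are nondegenerate, uniformly
in the length of the intervals. -/
theorem IsGaussianOfType.variance_lower {Ω : Type*} [MeasurableSpace Ω] {P : Measure Ω} {H : ℝ}
    (hH1 : H < 1) {X : ℝ → Ω → ℝ} (hX : IsGaussianOfType P H X) :
    ∃ c : ℝ, 0 < c ∧ ∀ K : ℕ, ∃ L₀ : ℕ, ∀ L : ℕ, L₀ ≤ L → ∀ t₀ δ : ℝ, 0 < t₀ → 0 < δ →
      t₀ + K * L * δ + δ < 1 → ∀ u : Fin K → ℝ,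
      c * δ ^ (2 * H) * ∑ j, u j ^ 2 ≤
        ∫ ω, (∑ j : Fin K, u j * (X (t₀ + j * L * δ + δ) ω - X (t₀ + j * L * δ) ω)) ^ 2 ∂P := by
  obtain ⟨c₁, c₂, c₃, h₁, h₂, h₃, hb⟩ := hX.bounds
  refine ⟨c₁ / 2, by positivity, fun K => ?_⟩
  -- The exponent 2H - 2 is negative, so for L large the off-diagonal covariances take at most half
  -- of the diagonal.
  have hlim : Tendsto (fun L : ℕ => c₃ * ((L : ℝ) - 1) ^ (2 * H - 2) * K) atTop (𝓝 0) := by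
    have h1 : Tendsto (fun L : ℕ => (L : ℝ) - 1) atTop atTop :=
      tendsto_atTop_add_const_right _ (-1) tendsto_natCast_atTop_atTop
    have h2 := (tendsto_rpow_neg_atTop (by linarith : 0 < 2 - 2 * H)).comp h1
    have h3 := (h2.const_mul c₃).mul_const (K : ℝ)
    simp only [Function.comp_def, mul_zero, zero_mul, neg_sub] at h3
    exact h3
  obtain ⟨L₀, hL₀⟩ := (((hlim.eventually_le_const h₁).and (eventually_ge_atTop 2))).exists_forall_of_atTop
  refine ⟨L₀, fun L hL t₀ δ ht₀ hδ h1 u => ?_⟩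
  obtain ⟨hLc, hL2⟩ := hL₀ L hL
  have hL2' : (2 : ℝ) ≤ L := by exact_mod_cast hL2
  set p : Fin K → ℝ := fun j => t₀ + j * L * δ with hp
  have hLδ : 0 < L * δ := by positivity
  have hp0 : ∀ j, 0 < p j := fun j => by simp only [hp]; positivity
  have hp1 : ∀ j, p j + δ < 1 := fun j => by
    refine lt_of_le_of_lt ?_ h1
    simp only [hp]
    have : (j : ℝ) ≤ K := by exact_mod_cast j.2.le
    gcongr
  have mI : ∀ j, p j ∈ Ioo (0 : ℝ) 1 := fun j => ⟨hp0 j, by linarith [hp1 j]⟩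
  have mI' : ∀ j, p j + δ ∈ Ioo (0 : ℝ) 1 := fun j => ⟨by linarith [hp0 j], hp1 j⟩
  set Δ : Fin K → Ω → ℝ := fun j ω => X (p j + δ) ω - X (p j) ω with hΔ
  have hΔL : ∀ j, MemLp (Δ j) 2 P := fun j =>
    hX.memLp_sub (Ioo_subset_Icc_self (mI j)) (Ioo_subset_Icc_self (mI' j))
  have hdiag : ∀ j, c₁ * δ ^ (2 * H) ≤ ∫ ω, Δ j ω * Δ j ω ∂P := by
    intro j
    have := (hb _ (mI j) _ (mI' j) (by linarith)).1
    simp only [add_sub_cancel_left, abs_of_pos hδ, incrVar] at this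
    simpa [hΔ, sq] using this
  have hlt : ∀ j k : Fin K, j < k → |∫ ω, Δ j ω * Δ k ω ∂P| ≤
      c₃ * ((L : ℝ) - 1) ^ (2 * H - 2) / 2 * δ ^ (2 * H) := by
    intro j k hjk
    have hjk' : (j : ℝ) + 1 ≤ k := by exact_mod_cast hjk
    have hpp : p j + L * δ ≤ p k := by
      have : ((j : ℝ) + 1) * (L * δ) ≤ k * (L * δ) := by gcongr
      simp only [hp]; linarith
    have hsp : δ + δ ≤ L * δ := by nlinarith
    have hDpos : 0 < ((L : ℝ) - 1) * δ := by nlinarith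
    have hr := incrVar_rect_le hX.contDiffOn h₃.le
      (fun s hs t ht hst => (hb s hs t ht hst).2.2) hH1 (hp0 j) (by linarith : p j < p j + δ)
      (hp1 j) (hp0 k) (by linarith : p k < p k + δ) (hp1 k) hDpos
      (fun s hs t ht => by
        rw [abs_of_pos (by linarith [hs.2, ht.1])]
        linarith [hs.2, ht.1])
      (fun s hs t ht => by
        have := hs.2; have := ht.1
        intro h; linarith)
    simp only [hΔ]
    rw [hX.integral_mul_sub (Ioo_subset_Icc_self (mI j)) (Ioo_subset_Icc_self (mI' j))
      (Ioo_subset_Icc_self (mI k)) (Ioo_subset_Icc_self (mI' k)), abs_mul]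
    have hL1 : (0 : ℝ) < L - 1 := by linarith
    -- δ^(2H-2) δ² = δ^(2H) is the order of the diagonal, which is why L can be chosen independently
    -- of δ.
    have e : (((L : ℝ) - 1) * δ) ^ (2 * H - 2) * δ * δ
        = ((L : ℝ) - 1) ^ (2 * H - 2) * δ ^ (2 * H) := by
      rw [Real.mul_rpow hL1.le hδ.le, Real.rpow_sub hδ, Real.rpow_two]
      field_simp
    calc _ ≤ |-(1 / 2 : ℝ)| * (c₃ * (((L : ℝ) - 1) * δ) ^ (2 * H - 2) *
          (p j + δ - p j) * (p k + δ - p k)) := by gcongr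
      _ = 1 / 2 * (c₃ * ((((L : ℝ) - 1) * δ) ^ (2 * H - 2) * δ * δ)) := by
          rw [abs_neg, abs_of_pos (by norm_num)]; ring
      _ = _ := by rw [e]; ring
  have hoff : ∀ j k : Fin K, j ≠ k → |∫ ω, Δ j ω * Δ k ω ∂P| ≤
      c₃ * ((L : ℝ) - 1) ^ (2 * H - 2) / 2 * δ ^ (2 * H) := by
    intro j k hjk
    rcases lt_or_gt_of_ne hjk with h | h
    · exact hlt j k h
    · have := hlt k j h
      simpa only [mul_comm] using this
  set q := c₃ * ((L : ℝ) - 1) ^ (2 * H - 2) / 2 * δ ^ (2 * H) with hq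
  have hL1 : (0 : ℝ) < L - 1 := by linarith
  have hq0 : 0 ≤ q := by positivity
  have hintegral : ∫ ω, (∑ j, u j * Δ j ω) ^ 2 ∂P =
      ∑ j, ∑ k, u j * u k * ∫ ω, Δ j ω * Δ k ω ∂P := by
    have e : ∀ ω, (∑ j, u j * Δ j ω) ^ 2 = ∑ j, ∑ k, u j * u k * (Δ j ω * Δ k ω) := fun ω => by
      rw [sq, Finset.sum_mul_sum]
      refine Finset.sum_congr rfl fun j _ => Finset.sum_congr rfl fun k _ => by ring
    simp_rw [e]
    have hi : ∀ j k, Integrable (fun ω => u j * u k * (Δ j ω * Δ k ω)) P := fun j k =>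
      ((hΔL j).integrable_mul (hΔL k)).const_mul _
    rw [integral_finsetSum _ fun j _ => integrable_finsetSum _ fun k _ => hi j k]
    refine Finset.sum_congr rfl fun j _ => ?_
    rw [integral_finsetSum _ fun k _ => hi j k]
    refine Finset.sum_congr rfl fun k _ => integral_const_mul _ _
  change _ ≤ ∫ ω, (∑ j, u j * Δ j ω) ^ 2 ∂P
  rw [hintegral]
  -- The off-diagonal bound q is charged on the diagonal as well: this only weakens the estimate and
  -- makes the total loss exactly q K ∑ u_j².
  have hterm : ∀ j k : Fin K, (if j = k then c₁ * δ ^ (2 * H) * u j ^ 2 else 0) -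
      q * ((u j ^ 2 + u k ^ 2) / 2) ≤ u j * u k * ∫ ω, Δ j ω * Δ k ω ∂P := by
    intro j k
    split_ifs with h
    · subst h
      have := mul_le_mul_of_nonneg_left (hdiag j) (sq_nonneg (u j))
      have h5 : 0 ≤ q * ((u j ^ 2 + u j ^ 2) / 2) := by positivity
      nlinarith
    · have h1 := hoff j k h
      have h2 : |u j * u k| ≤ (u j ^ 2 + u k ^ 2) / 2 := by
        rw [abs_le]; constructor <;> nlinarith [sq_nonneg (u j + u k), sq_nonneg (u j - u k)]
      have h3 : |u j * u k * ∫ ω, Δ j ω * Δ k ω ∂P| ≤ (u j ^ 2 + u k ^ 2) / 2 * q := by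
        rw [abs_mul]; gcongr
      have := neg_abs_le (u j * u k * ∫ ω, Δ j ω * Δ k ω ∂P)
      linarith
  refine le_trans ?_ (Finset.sum_le_sum fun j _ => Finset.sum_le_sum fun k _ => hterm j k)
  have hS : 0 ≤ ∑ j, u j ^ 2 := Finset.sum_nonneg fun j _ => sq_nonneg _
  have e : ∑ j, ∑ k, ((if j = k then c₁ * δ ^ (2 * H) * u j ^ 2 else 0) -
      q * ((u j ^ 2 + u k ^ 2) / 2)) = (c₁ * δ ^ (2 * H) - q * K) * ∑ j, u j ^ 2 := by
    simp only [Finset.sum_sub_distrib, Finset.sum_ite_eq, Finset.mem_univ, if_true,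
      ← Finset.mul_sum, ← Finset.sum_div, Finset.sum_add_distrib, Finset.sum_const,
      Finset.card_univ, Fintype.card_fin, nsmul_eq_mul]
    ring
  rw [e]
  gcongr
  have hδp : 0 < δ ^ (2 * H) := by positivity
  have : q * K ≤ c₁ / 2 * δ ^ (2 * H) := by
    calc q * K = (c₃ * ((L : ℝ) - 1) ^ (2 * H - 2) * K) / 2 * δ ^ (2 * H) := by rw [hq]; ring
      _ ≤ _ := by gcongr
  linarith

/-- Small ball estimate for linear combinations of increments of independent processes of
type `H`. -/
theorem smallBall_increments {Ω : Type*} [MeasurableSpace Ω] (P : Measure Ω)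
    [IsProbabilityMeasure P] {H : ℝ} (hH1 : H < 1) {m : ℕ} (B : Fin m → ℝ → Ω → ℝ)
    (hB_meas : ∀ i, ∀ t ∈ Icc (0 : ℝ) 1, Measurable (B i t))
    (hB_type : ∀ i, IsGaussianOfType P H (B i))
    (hB_indep : iIndepFun (fun i ω (t : Icc (0 : ℝ) 1) => B i t ω) P) :
    ∃ c : ℝ, 0 < c ∧ ∀ K : ℕ, ∃ L : ℕ, ∀ t₀ δ : ℝ, 0 < t₀ → 0 < δ →
      t₀ + K * L * δ + δ < 1 → ∀ (w : Fin m → ℝ) (θ η : ℝ), 0 < θ → 0 < η → (∃ i, θ ≤ |w i|) →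
      P {ω | ∀ j : Fin K, |∑ i, w i * (B i (t₀ + j * L * δ + δ) ω - B i (t₀ + j * L * δ) ω)| ≤ η} ≤
        ENNReal.ofReal ((c * (η / (θ * δ ^ H))) ^ K) := by
  choose c hc hcL using fun i => (hB_type i).variance_lower hH1
  obtain ⟨c₀, hc₀, hc₀le⟩ : ∃ c₀ : ℝ, 0 < c₀ ∧ ∀ i, c₀ ≤ c i := by
    rcases isEmpty_or_nonempty (Fin m) with hE | hN
    · exact ⟨1, one_pos, fun i => hE.elim i⟩
    · obtain ⟨i, hi⟩ := Finite.exists_min c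
      exact ⟨c i, hc i, hi⟩
  refine ⟨2 / √c₀, by positivity, fun K => ?_⟩
  choose L₀ hL₀ using fun i => hcL i K
  refine ⟨Finset.univ.sup L₀, fun t₀ δ ht₀ hδ h1 w θ η hθ hη hw => ?_⟩
  set L := Finset.univ.sup L₀ with hL
  obtain ⟨i₀, hi₀⟩ := hw
  have hp0 : ∀ j : Fin K, 0 ≤ t₀ + j * L * δ := fun j => by positivity
  have hp1 : ∀ j : Fin K, t₀ + j * L * δ + δ < 1 := fun j => by
    refine lt_of_le_of_lt ?_ h1
    have : (j : ℝ) ≤ K := by exact_mod_cast j.2.le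
    gcongr
  have m1 : ∀ j : Fin K, t₀ + j * L * δ ∈ Icc (0 : ℝ) 1 := fun j =>
    ⟨hp0 j, by linarith [hp1 j]⟩
  have m2 : ∀ j : Fin K, t₀ + j * L * δ + δ ∈ Icc (0 : ℝ) 1 := fun j =>
    ⟨by linarith [hp0 j], (hp1 j).le⟩
  set Δ : Fin m → Fin K → Ω → ℝ := fun i j ω =>
    B i (t₀ + j * L * δ + δ) ω - B i (t₀ + j * L * δ) ω with hΔ
  have hΔm : ∀ i j, Measurable (Δ i j) := fun i j => (hB_meas i _ (m2 j)).sub (hB_meas i _ (m1 j))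
  have hσ : 0 < √c₀ * (θ * δ ^ H) := by positivity
  have hmain := smallBall_of_charFun_le P (fun j ω => ∑ i, w i * Δ i j ω)
    (fun j => Finset.measurable_sum _ fun i _ => (hΔm i j).const_mul _) hσ hη ?_
  · refine hmain.trans (le_of_eq ?_)
    congr 2
    field_simp
  intro u
  set Y : Fin m → Ω → ℝ := fun i ω => ∑ j, u j * Δ i j ω with hY
  have hYm : ∀ i, Measurable (Y i) := fun i =>
    Finset.measurable_sum _ fun j _ => (hΔm i j).const_mul _
  have hYg : ∀ i, HasGaussianLaw (Y i) P := fun i =>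
    hasGaussianLaw_linearCombination (hB_type i).gaussian u (fun j => ⟨_, m1 j⟩)
      (fun j => ⟨_, m2 j⟩)
  have hintegral : ∀ i, ∀ t ∈ Icc (0 : ℝ) 1, Integrable (B i t) P := fun i t ht =>
    ((hB_type i).gaussian.hasGaussianLaw_eval ⟨t, ht⟩).integrable
  have hY0 : ∀ i, ∫ ω, Y i ω ∂P = 0 := fun i => by
    simp only [hY, hΔ]
    rw [integral_finsetSum _ fun j _ => by
      exact ((hintegral i _ (m2 j)).sub (hintegral i _ (m1 j))).const_mul _]
    refine Finset.sum_eq_zero fun j _ => ?_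
    rw [integral_const_mul, integral_sub (hintegral i _ (m2 j)) (hintegral i _ (m1 j)),
      (hB_type i).centred _ (m2 j), (hB_type i).centred _ (m1 j)]
    simp
  have hind : iIndepFun (fun i ω => w i * Y i ω) P := by
    have := hB_indep.comp (fun i (x : Icc (0 : ℝ) 1 → ℝ) =>
      w i * ∑ j, u j * (x ⟨_, m2 j⟩ - x ⟨_, m1 j⟩)) (fun i => by fun_prop)
    exact this
  have e1 : ∀ ω, ∑ j, u j * ∑ i, w i * Δ i j ω = ∑ i, w i * Y i ω := fun ω => by
    simp only [hY, Finset.mul_sum]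
    rw [Finset.sum_comm]
    refine Finset.sum_congr rfl fun i _ => Finset.sum_congr rfl fun j _ => by ring
  have e2 : ∫ ω, Complex.exp ((∑ j, u j * ∑ i, w i * Δ i j ω : ℝ) * Complex.I) ∂P =
      ∏ i, charFun (P.map (Y i)) (w i) := by
    simp_rw [e1]
    have hpr := congrFun (hind.charFun_map_fun_sum_eq_prod
      (fun i => ((hYm i).const_mul _).aemeasurable)) 1
    rw [charFun_apply_real, integral_map
      (Finset.measurable_sum _ fun i _ => (hYm i).const_mul _).aemeasurable
      (Measurable.aestronglyMeasurable (by fun_prop))] at hpr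
    simp only [Complex.ofReal_one, one_mul] at hpr
    rw [hpr, Finset.prod_apply]
    refine Finset.prod_congr rfl fun i _ => ?_
    rw [charFun_apply_real, charFun_apply_real, integral_map ((hYm i).const_mul _).aemeasurable
      (Measurable.aestronglyMeasurable (by fun_prop)), integral_map (hYm i).aemeasurable
      (Measurable.aestronglyMeasurable (by fun_prop))]
    simp
  rw [e2, norm_prod]
  -- Characteristic functions have modulus at most 1, so the one coordinate with |w i₀| ≥ θ supplies
  -- all the Gaussian decay.
  calc ∏ i, ‖charFun (P.map (Y i)) (w i)‖ ≤ ‖charFun (P.map (Y i₀)) (w i₀)‖ := by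
        rw [← Finset.mul_prod_erase _ _ (Finset.mem_univ i₀)]
        refine mul_le_of_le_one_right (norm_nonneg _)
          (Finset.prod_le_one (fun _ _ => norm_nonneg _) fun i _ => ?_)
        have := Measure.isProbabilityMeasure_map (μ := P) (hYm i).aemeasurable
        exact norm_charFun_le_one _
    _ ≤ _ := by
        rw [norm_charFun_of_centred (hYg i₀) (hY0 i₀)]
        refine Real.exp_le_exp.2 ?_
        have hv := hL₀ i₀ L (Finset.le_sup (Finset.mem_univ i₀)) t₀ δ ht₀ hδ h1 u
        have hS : 0 ≤ ∑ j, u j ^ 2 := Finset.sum_nonneg fun j _ => sq_nonneg _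
        have hδp : 0 < δ ^ (2 * H) := by positivity
        have hw2 : θ ^ 2 ≤ w i₀ ^ 2 := by
          rw [← sq_abs (w i₀)]; gcongr
        have e3 : (√c₀ * (θ * δ ^ H)) ^ 2 = c₀ * δ ^ (2 * H) * θ ^ 2 := by
          rw [mul_pow, mul_pow, Real.sq_sqrt hc₀.le, mul_comm 2 H, Real.rpow_mul hδ.le,
            Real.rpow_two]
          ring
        rw [e3]
        have h6 : c₀ * δ ^ (2 * H) * (∑ j, u j ^ 2) * θ ^ 2 ≤ (∫ ω, Y i₀ ω ^ 2 ∂P) * w i₀ ^ 2 := by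
          have : c₀ * δ ^ (2 * H) * ∑ j, u j ^ 2 ≤ ∫ ω, Y i₀ ω ^ 2 ∂P := by
            refine le_trans ?_ hv
            have := hc₀le i₀
            gcongr
          have h0 : 0 ≤ ∫ ω, Y i₀ ω ^ 2 ∂P := integral_nonneg fun ω => sq_nonneg _
          gcongr
        linarith

/-! ### Tails of Hölder constants -/

/-- Chaining: consecutive dyadic truncations of t differ by zero or one dyadic step, so f(t) is
reached from level n with an error given by a geometric series of ratio 2^(-α). -/
theorem holderBdd_of_dyadic {α : ℝ} (hα : 0 < α) : ∃ C : ℝ, 0 < C ∧ ∀ (Λ : ℝ) (f : ℝ → ℝ), 0 ≤ Λ →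
    ContinuousOn f (Icc 0 1) →
    (∀ n k : ℕ, k + 1 ≤ 2 ^ n →
      |f ((k + 1 : ℕ) / 2 ^ n) - f (k / 2 ^ n)| ≤ Λ * ((1 / 2) ^ n) ^ α) →
    HolderBdd α (C * Λ) f := by
  set r : ℝ := (1 / 2 : ℝ) ^ α with hr
  have hr0 : 0 < r := by positivity
  have hr1 : r < 1 := Real.rpow_lt_one (by norm_num) (by norm_num) hα
  have h1r : 0 < 1 - r := by linarith
  have hpow : ∀ n : ℕ, ((1 / 2 : ℝ) ^ n) ^ α = r ^ n := fun n => by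
    rw [hr, ← Real.rpow_natCast, ← Real.rpow_natCast, ← Real.rpow_mul (by norm_num),
      ← Real.rpow_mul (by norm_num), mul_comm]
  refine ⟨(1 + 2 / (1 - r)) / r, by positivity, fun Λ f hΛ hf hinc => ?_⟩
  simp only [hpow] at hinc
  set D : ℝ → ℕ → ℝ := fun t n => (⌊2 ^ n * t⌋₊ : ℝ) / 2 ^ n with hD
  have hfl : ∀ t ∈ Icc (0 : ℝ) 1, ∀ n : ℕ, ⌊2 ^ n * t⌋₊ ≤ 2 ^ n := fun t ht n => by
    have h : (2 : ℝ) ^ n * t ≤ (2 ^ n : ℕ) := by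
      push_cast
      exact mul_le_of_le_one_right (by positivity) ht.2
    exact Nat.floor_le_of_le h
  have hDm : ∀ t ∈ Icc (0 : ℝ) 1, ∀ n, D t n ∈ Icc (0 : ℝ) 1 := fun t ht n => by
    refine ⟨by positivity, ?_⟩
    rw [div_le_one (by positivity)]
    exact_mod_cast hfl t ht n
  have hstep : ∀ t ∈ Icc (0 : ℝ) 1, ∀ n, dist (f (D t n)) (f (D t (n + 1))) ≤ Λ * r ^ n := by
    intro t ht n
    have hy0 : 0 ≤ (2 : ℝ) ^ n * t := mul_nonneg (by positivity) ht.1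
    have e0 : (2 : ℝ) ^ (n + 1) * t = 2 * (2 ^ n * t) := by rw [pow_succ]; ring
    have hlo : 2 * ⌊2 ^ n * t⌋₊ ≤ ⌊2 ^ (n + 1) * t⌋₊ := by
      refine Nat.le_floor ?_
      push_cast
      rw [e0]
      have := Nat.floor_le hy0
      linarith
    have hhi : ⌊2 ^ (n + 1) * t⌋₊ < 2 * ⌊2 ^ n * t⌋₊ + 2 := by
      rw [Nat.floor_lt (by rw [e0]; linarith)]
      push_cast
      rw [e0]
      have := Nat.lt_floor_add_one (2 ^ n * t)
      linarith
    have e1 : D t n = ((2 * ⌊2 ^ n * t⌋₊ : ℕ) : ℝ) / 2 ^ (n + 1) := by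
      simp only [hD]; push_cast; rw [pow_succ]; field_simp
    have hcase : ⌊2 ^ (n + 1) * t⌋₊ = 2 * ⌊2 ^ n * t⌋₊ ∨
        ⌊2 ^ (n + 1) * t⌋₊ = 2 * ⌊2 ^ n * t⌋₊ + 1 := by omega
    rcases hcase with h | h
    · rw [e1]
      simp only [hD, h, dist_self]
      positivity
    · rw [e1, dist_comm, Real.dist_eq]
      simp only [hD, h]
      refine (hinc (n + 1) _ (h ▸ hfl t ht (n + 1))).trans ?_
      have : r ^ (n + 1) ≤ r ^ n := pow_le_pow_of_le_one hr0.le hr1.le (Nat.le_succ n)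
      gcongr
  have hlim : ∀ t ∈ Icc (0 : ℝ) 1, Tendsto (fun n => f (D t n)) atTop (𝓝 (f t)) := by
    intro t ht
    have h1 : Tendsto (D t) atTop (𝓝 t) := by
      have := (tendsto_nat_floor_mul_div_atTop ht.1).comp
        (tendsto_pow_atTop_atTop_of_one_lt (by norm_num : (1 : ℝ) < 2))
      refine this.congr fun n => ?_
      simp [hD, mul_comm]
    exact (hf t ht).tendsto.comp (tendsto_nhdsWithin_iff.2
      ⟨h1, Eventually.of_forall fun n => hDm t ht n⟩)
  have hfar : ∀ t ∈ Icc (0 : ℝ) 1, ∀ n, |f (D t n) - f t| ≤ Λ * r ^ n / (1 - r) := fun t ht n =>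
    dist_le_of_le_geometric_of_tendsto _ _ hr1 (hstep t ht) (hlim t ht) n
  have hlt : ∀ s ∈ Icc (0 : ℝ) 1, ∀ t ∈ Icc (0 : ℝ) 1, s < t →
      |f t - f s| ≤ (1 + 2 / (1 - r)) / r * Λ * |t - s| ^ α := by
    intro s hs t ht hst
    -- At the level with t - s between 2^(-n-1) and 2^(-n), the truncations of s and t are equal or
    -- adjacent.
    obtain ⟨n, h1, h2⟩ := exists_nat_pow_near_of_lt_one (sub_pos.2 hst)
      (by linarith [hs.1, ht.2] : t - s ≤ 1) (by norm_num : (0 : ℝ) < 1 / 2) (by norm_num)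
    have hmono : ⌊2 ^ n * s⌋₊ ≤ ⌊2 ^ n * t⌋₊ := Nat.floor_mono (by gcongr)
    have hle : ⌊2 ^ n * t⌋₊ ≤ ⌊2 ^ n * s⌋₊ + 1 := by
      rw [← Nat.floor_add_one (mul_nonneg (by positivity) hs.1)]
      refine Nat.floor_mono ?_
      have : (2 : ℝ) ^ n * (t - s) ≤ 2 ^ n * (1 / 2) ^ n := by gcongr
      rw [← mul_pow] at this
      norm_num at this
      linarith
    have hmid : |f (D t n) - f (D s n)| ≤ Λ * r ^ n := by
      have hcase : ⌊2 ^ n * t⌋₊ = ⌊2 ^ n * s⌋₊ ∨ ⌊2 ^ n * t⌋₊ = ⌊2 ^ n * s⌋₊ + 1 := by omega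
      rcases hcase with h | h
      · simp only [hD, h, sub_self, abs_zero]
        positivity
      · simp only [hD, h]
        exact hinc n _ (h ▸ hfl t ht n)
    have hrn : r ^ n ≤ (t - s) ^ α / r := by
      rw [le_div_iff₀ hr0, ← pow_succ, ← hpow]
      exact Real.rpow_le_rpow (by positivity) h1.le hα.le
    rw [abs_of_pos (sub_pos.2 hst)]
    have a1 := hfar t ht n
    have a2 := hfar s hs n
    calc |f t - f s| = |-(f (D t n) - f t) + (f (D t n) - f (D s n)) + (f (D s n) - f s)| := by
          congr 1; ring
      _ ≤ Λ * r ^ n / (1 - r) + Λ * r ^ n + Λ * r ^ n / (1 - r) := by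
          refine (abs_add_three _ _ _).trans ?_
          rw [abs_neg]
          gcongr
      _ = (1 + 2 / (1 - r)) * Λ * r ^ n := by ring
      _ ≤ (1 + 2 / (1 - r)) * Λ * ((t - s) ^ α / r) := by gcongr
      _ = _ := by ring
  intro s hs t ht
  rcases lt_trichotomy s t with h | h | h
  · exact hlt s hs t ht h
  · subst h
    simp [Real.zero_rpow hα.ne']
  · rw [abs_sub_comm, abs_sub_comm t s]
    exact hlt t ht s hs h

/-- By scaling, Y is √v times a standard normal variable with v ≤ σ², and Markov's inequality for
its p-th absolute moment suffices. The case v = 0 is included. -/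
theorem gaussian_tail {p : ℝ} (hp : 0 < p) : ∃ c : ℝ, 0 < c ∧
    ∀ {Ω : Type*} [MeasurableSpace Ω] (P : Measure Ω) [IsProbabilityMeasure P] (Y : Ω → ℝ)
    (σ x : ℝ), HasGaussianLaw Y P → ∫ ω, Y ω ∂P = 0 → 0 < σ → ∫ ω, Y ω ^ 2 ∂P ≤ σ ^ 2 → 0 < x →
    P {ω | x < |Y ω|} ≤ ENNReal.ofReal (c * (σ / x) ^ p) := by
  set γ := gaussianReal 0 1 with hγ
  have hintegral : Integrable (fun z : ℝ => |z| ^ p) γ := by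
    have h := (memLp_id_gaussianReal' (μ := 0) (v := 1) (ENNReal.ofReal p)
      ENNReal.ofReal_ne_top).integrable_norm_rpow (by simpa using hp) ENNReal.ofReal_ne_top
    simpa [ENNReal.toReal_ofReal hp.le] using h
  have hI : 0 ≤ ∫ z, |z| ^ p ∂γ := integral_nonneg fun z => by positivity
  refine ⟨∫ z, |z| ^ p ∂γ + 1, by positivity, ?_⟩
  intro Ω _ P _ Y σ x hY hmean hσ hvar hx
  have hv : Var[Y; P] = ∫ ω, Y ω ^ 2 ∂P := by
    rw [variance_eq_integral hY.aemeasurable]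
    simp [hmean]
  set v := ∫ ω, Y ω ^ 2 ∂P with hvdef
  have hv0 : 0 ≤ v := integral_nonneg fun ω => sq_nonneg _
  have hlaw : P.map Y = γ.map (√v * ·) := by
    rw [hY.map_eq_gaussianReal, hγ, gaussianReal_map_const_mul, hv, hmean]
    congr 1
    · simp
    · ext
      simp [Real.sq_sqrt hv0, hv0]
  have hms : MeasurableSet {y : ℝ | x < |y|} := measurableSet_lt measurable_const (by fun_prop)
  have e1 : P {ω | x < |Y ω|} = γ {z | x < |√v * z|} := by
    have := congrArg (fun μ => μ {y : ℝ | x < |y|}) hlaw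
    rw [Measure.map_apply_of_aemeasurable hY.aemeasurable hms,
      Measure.map_apply (by fun_prop) hms] at this
    exact this
  have hsub : {z : ℝ | x < |√v * z|} ⊆ {z | (x / σ) ^ p ≤ |z| ^ p} := by
    intro z hz
    simp only [mem_ofPred_eq] at hz ⊢
    refine Real.rpow_le_rpow (by positivity) ?_ hp.le
    rw [div_le_iff₀ hσ]
    rw [abs_mul, abs_of_nonneg (Real.sqrt_nonneg v)] at hz
    have : √v ≤ σ := Real.sqrt_le_iff.2 ⟨hσ.le, hvar⟩
    nlinarith [abs_nonneg z]
  rw [e1]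
  refine (measure_mono hsub).trans ?_
  have hmk := mul_meas_ge_le_integral_of_nonneg
    (ae_of_all γ fun z : ℝ => (by positivity : (0 : ℝ) ≤ |z| ^ p)) hintegral ((x / σ) ^ p)
  have hpos : 0 < (x / σ) ^ p := by positivity
  rw [← ENNReal.ofReal_toReal (measure_ne_top γ {z | (x / σ) ^ p ≤ |z| ^ p})]
  refine ENNReal.ofReal_le_ofReal ?_
  rw [← inv_div x σ, Real.inv_rpow (by positivity), ← div_eq_mul_inv, le_div_iff₀ hpos, mul_comm]
  exact hmk.trans (by linarith)

/-- The type-H bounds hold inside (0,1) only, whereas dyadic chaining uses the endpoints. Path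
continuity and Fatou's lemma carry the upper bound to the closed interval. -/
theorem IsGaussianOfType.incrVar_le {Ω : Type*} [MeasurableSpace Ω] {P : Measure Ω} {H : ℝ}
    (hH : 0 < H) {X : ℝ → Ω → ℝ} (hX : IsGaussianOfType P H X)
    (hcont : ∀ᵐ ω ∂P, ContinuousOn (fun t => X t ω) (Icc 0 1)) :
    ∃ c : ℝ, 0 < c ∧ ∀ s ∈ Icc (0 : ℝ) 1, ∀ t ∈ Icc (0 : ℝ) 1,
      incrVar P X s t ≤ c * |t - s| ^ (2 * H) := by
  obtain ⟨c₁, c₂, c₃, h₁, h₂, h₃, hb⟩ := hX.bounds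
  refine ⟨c₂, h₂, fun s hs t ht => ?_⟩
  set a : ℕ → ℝ := fun n => 1 / ((n : ℝ) + 2) with ha
  have ha0 : ∀ n, 0 < a n := fun n => by positivity
  have ha1 : ∀ n, a n < 1 := fun n => by
    simp only [ha]
    rw [div_lt_one (by positivity)]
    have : (0 : ℝ) ≤ n := by positivity
    linarith
  have hat : Tendsto a atTop (𝓝 0) := by
    have h := tendsto_one_div_add_atTop_nhds_zero_nat (𝕜 := ℝ)
    refine ((tendsto_add_atTop_iff_nat 1).2 h).congr fun n => ?_
    simp only [ha]; push_cast; ring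
  -- A contraction towards 1/2: the approximating points are interior and no farther apart than s
  -- and t, so the constant is unchanged.
  set c : ℝ → ℕ → ℝ := fun x n => x + (1 / 2 - x) * a n with hcdef
  have hcm : ∀ x ∈ Icc (0 : ℝ) 1, ∀ n, c x n ∈ Ioo (0 : ℝ) 1 := fun x hx n => by
    have := ha0 n; have := ha1 n; have := hx.1; have := hx.2
    constructor <;> simp only [hcdef] <;> nlinarith
  have hct : ∀ x, Tendsto (c x) atTop (𝓝 x) := fun x => by
    have h := (hat.const_mul (1 / 2 - x)).const_add x
    rwa [mul_zero, add_zero] at h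
  have hbd : ∀ n, incrVar P X (c s n) (c t n) ≤ c₂ * |t - s| ^ (2 * H) := by
    intro n
    have hd : |c t n - c s n| ≤ |t - s| := by
      rw [show c t n - c s n = (1 - a n) * (t - s) by simp only [hcdef]; ring, abs_mul,
        abs_of_pos (by linarith [ha1 n])]
      exact mul_le_of_le_one_left (abs_nonneg _) (by linarith [ha0 n])
    by_cases hne : c s n = c t n
    · rw [hne]
      simp only [incrVar, sub_self]
      simp only [ne_eq, OfNat.ofNat_ne_zero, not_false_eq_true, zero_pow, integral_zero]
      positivity
    · refine (hb _ (hcm s hs n) _ (hcm t ht n) hne).2.1.trans ?_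
      gcongr
  have hmem : ∀ x ∈ Icc (0 : ℝ) 1, ∀ y ∈ Icc (0 : ℝ) 1,
      Integrable (fun ω => (X y ω - X x ω) ^ 2) P := fun x hx y hy =>
    (hX.memLp_sub hx hy).integrable_sq
  have hlin : ∀ x ∈ Icc (0 : ℝ) 1, ∀ y ∈ Icc (0 : ℝ) 1, ENNReal.ofReal (incrVar P X x y) =
      ∫⁻ ω, ENNReal.ofReal ((X y ω - X x ω) ^ 2) ∂P := fun x hx y hy =>
    ofReal_integral_eq_lintegral_ofReal (hmem x hx y hy) (ae_of_all _ fun ω => sq_nonneg _)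
  have hnn : 0 ≤ c₂ * |t - s| ^ (2 * H) := by positivity
  rw [← ENNReal.ofReal_le_ofReal_iff hnn, hlin s hs t ht]
  calc ∫⁻ ω, ENNReal.ofReal ((X t ω - X s ω) ^ 2) ∂P
      ≤ ∫⁻ ω, liminf (fun n => ENNReal.ofReal ((X (c t n) ω - X (c s n) ω) ^ 2)) atTop ∂P := by
        refine lintegral_mono_ae ?_
        filter_upwards [hcont] with ω hω
        have hx : ∀ x ∈ Icc (0 : ℝ) 1, Tendsto (fun n => X (c x n) ω) atTop (𝓝 (X x ω)) :=
          fun x hx => (hω x hx).tendsto.comp (tendsto_nhdsWithin_iff.2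
            ⟨hct x, Eventually.of_forall fun n => Ioo_subset_Icc_self (hcm x hx n)⟩)
        exact (ENNReal.tendsto_ofReal (((hx t ht).sub (hx s hs)).pow 2)).liminf_eq.ge
    _ ≤ liminf (fun n => ∫⁻ ω, ENNReal.ofReal ((X (c t n) ω - X (c s n) ω) ^ 2) ∂P) atTop :=
        lintegral_liminf_le' fun n => ((hmem _ (Ioo_subset_Icc_self (hcm s hs n)) _
          (Ioo_subset_Icc_self (hcm t ht n))).aemeasurable).ennreal_ofReal
    _ ≤ ENNReal.ofReal (c₂ * |t - s| ^ (2 * H)) := by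
        refine liminf_le_of_le (by isBoundedDefault) fun b hb' => ?_
        obtain ⟨n, hn⟩ := hb'.exists
        refine hn.trans ?_
        rw [← hlin _ (Ioo_subset_Icc_self (hcm s hs n)) _ (Ioo_subset_Icc_self (hcm t ht n))]
        exact ENNReal.ofReal_le_ofReal (hbd n)

/-- The Hölder constant of a process of type `H` has moments of all orders. -/
theorem IsGaussianOfType.holder_tail {Ω : Type*} [MeasurableSpace Ω] {P : Measure Ω}
    [IsProbabilityMeasure P] {H α : ℝ} (hα : 0 < α) (hαH : α < H) {X : ℝ → Ω → ℝ}
    (hX : IsGaussianOfType P H X)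
    (hcont : ∀ᵐ ω ∂P, ContinuousOn (fun t => X t ω) (Icc 0 1)) {p : ℝ} :
    ∃ C : ℝ, 0 < C ∧ ∀ Λ : ℝ, 1 ≤ Λ →
      P {ω | ¬ HolderBdd α Λ (fun t => X t ω)} ≤ ENNReal.ofReal (C * Λ ^ (-p)) := by
  obtain ⟨C₁, hC₁, hdy⟩ := holderBdd_of_dyadic hα
  obtain ⟨c₂, hc₂, hvar⟩ := hX.incrVar_le (hα.trans hαH) hcont
  -- With (H - α) q ≥ 2 each increment of level n is too large with probability O(4^(-n)), which
  -- beats the 2^n increments of that level; q ≥ p gives the required decay in Λ.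
  set q : ℝ := max p (2 / (H - α)) with hq
  have hHα : 0 < H - α := by linarith
  have hq2 : 2 ≤ (H - α) * q := by
    have : 2 / (H - α) ≤ q := le_max_right _ _
    rw [div_le_iff₀ hHα] at this
    linarith
  have hq0 : 0 < q := lt_of_lt_of_le (by positivity) (le_max_right _ _)
  obtain ⟨cq, hcq, htail⟩ := gaussian_tail hq0
  refine ⟨2 * (cq * (√c₂ * C₁) ^ q), by positivity, fun Λ hΛ => ?_⟩
  have hΛ0 : 0 < Λ := by linarith
  set x : ℕ → ℝ := fun n => Λ / C₁ * ((1 / 2) ^ n) ^ α with hx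
  have hx0 : ∀ n, 0 < x n := fun n => by positivity
  set E : ℕ → ℕ → Set Ω := fun n k =>
    {ω | x n < |X ((k + 1 : ℕ) / 2 ^ n) ω - X (k / 2 ^ n) ω|} with hE
  have hmem : ∀ n k : ℕ, k ≤ 2 ^ n → (k : ℝ) / 2 ^ n ∈ Icc (0 : ℝ) 1 := fun n k hk => by
    refine ⟨by positivity, ?_⟩
    rw [div_le_one (by positivity)]
    exact_mod_cast hk
  have hEP : ∀ n, ∀ k ∈ Finset.range (2 ^ n), P (E n k) ≤
      ENNReal.ofReal (cq * (√c₂ * C₁ / Λ) ^ q * ((1 / 4) ^ n)) := by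
    intro n k hk
    have hk' := Finset.mem_range.1 hk
    have mk := hmem n k hk'.le
    have mk1 := hmem n (k + 1) hk'
    have hg := hX.gaussian.hasGaussianLaw_fun_sub (s := ⟨_, mk1⟩) (t := ⟨_, mk⟩)
    have hintegral : ∀ t (ht : t ∈ Icc (0 : ℝ) 1), Integrable (X t) P := fun t ht =>
      (hX.gaussian.hasGaussianLaw_eval ⟨t, ht⟩).integrable
    have hmean : ∫ ω, (X ((k + 1 : ℕ) / 2 ^ n) ω - X (k / 2 ^ n) ω) ∂P = 0 := by
      rw [integral_sub (hintegral _ mk1) (hintegral _ mk), hX.centred _ mk1, hX.centred _ mk, sub_self]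
    have hσ : 0 < √c₂ * ((1 / 2) ^ n) ^ H := by positivity
    have hd : |((k + 1 : ℕ) : ℝ) / 2 ^ n - k / 2 ^ n| = (1 / 2) ^ n := by
      rw [← sub_div, Nat.cast_add_one, add_sub_cancel_left, abs_of_pos (by positivity), one_div_pow]
    have hv : ∫ ω, (X ((k + 1 : ℕ) / 2 ^ n) ω - X (k / 2 ^ n) ω) ^ 2 ∂P ≤
        (√c₂ * ((1 / 2) ^ n) ^ H) ^ 2 := by
      have h := hvar _ mk _ mk1
      rw [hd] at h
      refine h.trans (le_of_eq ?_)
      rw [mul_pow, Real.sq_sqrt hc₂.le, mul_comm 2 H, Real.rpow_mul (by positivity), Real.rpow_two]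
    refine (htail P _ _ (x n) hg hmean hσ hv (hx0 n)).trans (ENNReal.ofReal_le_ofReal ?_)
    have e : √c₂ * ((1 / 2) ^ n) ^ H / x n = √c₂ * C₁ / Λ * ((1 / 2) ^ n) ^ (H - α) := by
      rw [Real.rpow_sub (by positivity)]
      simp only [hx]
      field_simp
    rw [e, Real.mul_rpow (by positivity) (by positivity), ← Real.rpow_mul (by positivity), mul_assoc]
    gcongr
    calc ((1 / 2 : ℝ) ^ n) ^ ((H - α) * q) ≤ ((1 / 2 : ℝ) ^ n) ^ (2 : ℝ) :=
          Real.rpow_le_rpow_of_exponent_ge (by positivity)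
            (pow_le_one₀ (by norm_num) (by norm_num)) hq2
      _ = (1 / 4) ^ n := by
          rw [Real.rpow_two, ← pow_mul, mul_comm, pow_mul]; norm_num
  have hsub : {ω | ¬ HolderBdd α Λ (fun t => X t ω)} ⊆
      {ω | ¬ ContinuousOn (fun t => X t ω) (Icc 0 1)} ∪
        ⋃ n, ⋃ k ∈ Finset.range (2 ^ n), E n k := by
    intro ω hω
    by_contra hcon
    simp only [mem_union, mem_ofPred_eq, mem_iUnion, not_or, not_not, not_exists, hE, not_lt,
      Finset.mem_range] at hcon
    refine hω ?_
    have h := hdy (Λ / C₁) (fun t => X t ω) (by positivity) hcon.1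
      (fun n k hk => hcon.2 n k hk)
    rwa [mul_div_cancel₀ _ hC₁.ne'] at h
  set A : ℝ := cq * (√c₂ * C₁ / Λ) ^ q with hA
  have hA0 : 0 ≤ A := by positivity
  calc _ ≤ P {ω | ¬ ContinuousOn (fun t => X t ω) (Icc 0 1)} +
        P (⋃ n, ⋃ k ∈ Finset.range (2 ^ n), E n k) :=
        (measure_mono hsub).trans (measure_union_le _ _)
    _ = P (⋃ n, ⋃ k ∈ Finset.range (2 ^ n), E n k) := by
        rw [show P {ω | ¬ ContinuousOn (fun t => X t ω) (Icc 0 1)} = 0 from hcont, zero_add]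
    _ ≤ ∑' n, ENNReal.ofReal (A * (1 / 2) ^ n) := by
        refine (measure_iUnion_le _).trans (ENNReal.tsum_le_tsum fun n => ?_)
        refine (measure_biUnion_finset_le _ _).trans ((Finset.sum_le_sum (hEP n)).trans ?_)
        rw [Finset.sum_const, Finset.card_range, nsmul_eq_mul, ← ENNReal.ofReal_natCast,
          ← ENNReal.ofReal_mul (by positivity)]
        refine ENNReal.ofReal_le_ofReal (le_of_eq ?_)
        push_cast
        rw [mul_left_comm, ← mul_pow]
        norm_num
    _ = ENNReal.ofReal (A * 2) := by
        rw [← ENNReal.ofReal_tsum_of_nonneg (fun n => by positivity)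
          (summable_geometric_two.mul_left A), tsum_mul_left, tsum_geometric_two]
    _ ≤ _ := by
        refine ENNReal.ofReal_le_ofReal ?_
        have : Λ ^ (-q) ≤ Λ ^ (-p) :=
          Real.rpow_le_rpow_of_exponent_le hΛ (neg_le_neg (le_max_left _ _))
        calc A * 2 = 2 * (cq * (√c₂ * C₁) ^ q) * Λ ^ (-q) := by
              rw [hA, Real.div_rpow (by positivity) hΛ0.le, Real.rpow_neg hΛ0.le]; ring
          _ ≤ _ := by gcongr

/-- Markov's inequality for the lower integral: N need not be measurable, provided the event E is
null-measurable. Moments are given for orders at least 1 only, hence `max p 1`; Λ ≥ 1 allows the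
return to p. -/
theorem measure_le_of_moment {Ω : Type*} [MeasurableSpace Ω] {P : Measure Ω} {N : Ω → ℝ≥0∞}
    (hN : ∀ p : ℝ, 1 ≤ p → ∫⁻ ω, N ω ^ p ∂P < ∞) (p : ℝ) : ∃ C : ℝ, 0 < C ∧
    ∀ (Λ : ℝ) (E : Set Ω), 1 ≤ Λ → NullMeasurableSet E P → (∀ ω ∈ E, ENNReal.ofReal Λ ≤ N ω) →
      P E ≤ ENNReal.ofReal (C * Λ ^ (-p)) := by
  set q := max p 1 with hq
  have hI := hN q (le_max_right _ _)
  set I := ∫⁻ ω, N ω ^ q ∂P with hIdef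
  refine ⟨I.toReal + 1, by positivity, fun Λ E hΛ hE hle => ?_⟩
  have hΛ0 : 0 < Λ := by linarith
  have hq0 : 0 ≤ q := zero_le_one.trans (le_max_right _ _)
  have h1 : ENNReal.ofReal (Λ ^ q) * P E ≤ I := by
    rw [← lintegral_indicator_const₀ hE]
    refine lintegral_mono fun ω => ?_
    by_cases hω : ω ∈ E
    · rw [indicator_of_mem hω, ← ENNReal.ofReal_rpow_of_nonneg hΛ0.le hq0]
      exact ENNReal.rpow_le_rpow (hle ω hω) hq0
    · simp [indicator_of_notMem hω]
  have hpos : 0 < Λ ^ q := by positivity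
  have h2 : P E ≤ ENNReal.ofReal (I.toReal * Λ ^ (-q)) := by
    rw [Real.rpow_neg hΛ0.le, ← div_eq_mul_inv, ENNReal.ofReal_div_of_pos hpos,
      ENNReal.ofReal_toReal hI.ne, ENNReal.le_div_iff_mul_le (Or.inl (by simpa using hpos))
      (Or.inl ENNReal.ofReal_ne_top), mul_comm]
    exact h1
  refine h2.trans (ENNReal.ofReal_le_ofReal ?_)
  have : Λ ^ (-q) ≤ Λ ^ (-p) :=
    Real.rpow_le_rpow_of_exponent_le hΛ (neg_le_neg (le_max_left _ _))
  have h0 : 0 ≤ Λ ^ (-p) := by positivity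
  calc I.toReal * Λ ^ (-q) ≤ I.toReal * Λ ^ (-p) := by gcongr
    _ ≤ _ := by nlinarith

/-- Polynomial tails of the Hölder constant and of the supremum of a process whose Hölder norm has
moments of all orders. -/
theorem holder_sup_tail {Ω : Type*} [MeasurableSpace Ω] {P : Measure Ω} {X : ℝ → Ω → ℝ}
    (hmeas : ∀ t ∈ Icc (0 : ℝ) 1, AEMeasurable (X t) P)
    (hcont : ∀ᵐ ω ∂P, ContinuousOn (fun t => X t ω) (Icc 0 1)) {r : ℝ≥0}
    (hmom : ∀ p : ℝ, 1 ≤ p → ∫⁻ ω, holderNorm r (fun t => X t ω) ^ p ∂P < ∞) (p : ℝ) :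
    ∃ C : ℝ, 0 < C ∧ ∀ Λ : ℝ, 1 ≤ Λ →
      P {ω | ¬ (HolderBdd r Λ (fun t => X t ω) ∧ ∀ t ∈ Icc (0 : ℝ) 1, |X t ω| ≤ Λ)} ≤
        ENNReal.ofReal (C * Λ ^ (-p)) := by
  obtain ⟨C, hC, hCE⟩ := measure_le_of_moment hmom p
  refine ⟨C, hC, fun Λ hΛ => ?_⟩
  have hΛ0 : 0 < Λ := by linarith
  have : Nonempty (Icc (0 : ℝ) 1) := ⟨⟨0, le_rfl, zero_le_one⟩⟩
  set d : ℕ → Icc (0 : ℝ) 1 := TopologicalSpace.denseSeq (Icc (0 : ℝ) 1) with hd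
  have hdd : DenseRange d := TopologicalSpace.denseRange_denseSeq _
  -- Only countably many times enter, so E is null-measurable; on its complement, path continuity
  -- extends the bounds from the dense set to [0,1].
  set E : Set Ω := (⋃ i, ⋃ j, {ω | Λ * |(d j : ℝ) - d i| ^ (r : ℝ) < |X (d j) ω - X (d i) ω|}) ∪
    ⋃ i, {ω | Λ < |X (d i) ω|} with hE
  have hEm : NullMeasurableSet E P := by
    refine NullMeasurableSet.union (.iUnion fun i => .iUnion fun j => ?_) (.iUnion fun i => ?_)
    · have := (hmeas _ (d i).2); have := (hmeas _ (d j).2)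
      exact nullMeasurableSet_lt aemeasurable_const (by fun_prop)
    · have := (hmeas _ (d i).2)
      exact nullMeasurableSet_lt aemeasurable_const (by fun_prop)
  have hEle : ∀ ω ∈ E, ENNReal.ofReal Λ ≤ holderNorm r (fun t => X t ω) := by
    intro ω hω
    rcases hω with hω | hω
    · simp only [mem_iUnion, mem_ofPred_eq] at hω
      obtain ⟨i, j, hij⟩ := hω
      refine le_trans ?_ (le_add_left le_rfl)
      by_contra hlt
      rw [not_le, eHolderNorm, iInf_lt_iff] at hlt
      obtain ⟨K, hK⟩ := hlt
      rw [iInf_lt_iff] at hK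
      obtain ⟨hKh, hKΛ⟩ := hK
      have h1 := hKh.dist_le (d j) (d i)
      rw [Real.dist_eq, Subtype.dist_eq, Real.dist_eq] at h1
      have h2 : (K : ℝ) ≤ Λ := by
        have := (ENNReal.lt_ofReal_iff_toReal_lt ENNReal.coe_ne_top).1 hKΛ
        simpa using this.le
      have : (K : ℝ) * |(d j : ℝ) - d i| ^ (r : ℝ) ≤ Λ * |(d j : ℝ) - d i| ^ (r : ℝ) := by gcongr
      linarith
    · simp only [mem_iUnion, mem_ofPred_eq] at hω
      obtain ⟨i, hi⟩ := hω
      refine le_trans ?_ (le_add_right le_rfl)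
      refine le_trans ?_ (le_iSup₂ (f := fun t (_ : t ∈ Icc (0 : ℝ) 1) => ‖X t ω‖ₑ) (d i) (d i).2)
      rw [Real.enorm_eq_ofReal_abs]
      exact ENNReal.ofReal_le_ofReal hi.le
  have hsub : {ω | ¬ (HolderBdd r Λ (fun t => X t ω) ∧ ∀ t ∈ Icc (0 : ℝ) 1, |X t ω| ≤ Λ)} ⊆
      {ω | ¬ ContinuousOn (fun t => X t ω) (Icc 0 1)} ∪ E := by
    intro ω hω
    by_contra hcon
    simp only [mem_union, mem_ofPred_eq, mem_iUnion, not_or, not_not, not_exists, hE, not_lt]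
      at hcon
    obtain ⟨hc, h1, h2⟩ := hcon
    have hc' : Continuous fun t : Icc (0 : ℝ) 1 => X t ω := continuousOn_iff_continuous_domRestrict.1 hc
    refine hω ⟨fun s hs t ht => ?_, fun t ht => ?_⟩
    · refine hdd.induction_on₂ (p := fun s t : Icc (0 : ℝ) 1 =>
        |X t ω - X s ω| ≤ Λ * |(t : ℝ) - s| ^ (r : ℝ)) ?_ h1 ⟨s, hs⟩ ⟨t, ht⟩
      refine isClosed_le ?_ ?_
      · exact ((hc'.comp continuous_snd).sub (hc'.comp continuous_fst)).abs
      · refine continuous_const.mul (Continuous.rpow_const (by fun_prop) fun _ => Or.inr r.2)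
    · refine hdd.induction_on (p := fun t : Icc (0 : ℝ) 1 => |X t ω| ≤ Λ) ⟨t, ht⟩ ?_ h2
      exact isClosed_le hc'.abs continuous_const
  calc _ ≤ P {ω | ¬ ContinuousOn (fun t => X t ω) (Icc 0 1)} + P E :=
        (measure_mono hsub).trans (measure_union_le _ _)
    _ = P E := by
        rw [show P {ω | ¬ ContinuousOn (fun t => X t ω) (Icc 0 1)} = 0 from hcont, zero_add]
    _ ≤ _ := hCE Λ E hΛ hEm hEle

/-! ### Deterministic estimates on paths -/

theorem eventually_mul_rpow_le_one (A : ℝ) {e : ℝ} (he : 0 < e) :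
    ∀ᶠ ε : ℝ in 𝓝[>] 0, A * ε ^ e ≤ 1 := by
  have h : Tendsto (fun ε : ℝ => A * ε ^ e) (𝓝[>] 0) (𝓝 0) := by
    have h1 : Continuous fun ε : ℝ => A * ε ^ e :=
      continuous_const.mul (Real.continuous_rpow_const he.le)
    have h2 := h1.tendsto 0
    rw [Real.zero_rpow he.ne', mul_zero] at h2
    exact h2.mono_left nhdsWithin_le_nhds
  exact h.eventually_le_const one_pos

/-- The path `t ↦ ∫_0^t a(s) ds + ∑_i ∫_0^t b^i dB^i` for given paths `a`, `b`, `B`. -/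
noncomputable def norrisPath {m : ℕ} (a : ℝ → ℝ) (b B : Fin m → ℝ → ℝ) (t : ℝ) : ℝ :=
  (∫ s in (0 : ℝ)..t, a s) + ∑ i, youngIntegral (b i) (B i) 0 t

/-- The Young–Loève estimate summed over the coordinates. It enters as a hypothesis so that one
constant C, fixed before ε and the paths, serves throughout. -/
theorem norrisPath_sub_le {α C Λ : ℝ} {m : ℕ} {a : ℝ → ℝ} {b B : Fin m → ℝ → ℝ}
    (hC : ∀ (R M : ℝ) (f g : ℝ → ℝ), HolderBdd α R f → HolderBdd α M g →
      ∀ u ∈ Icc (0 : ℝ) 1, ∀ v ∈ Icc (0 : ℝ) 1, u ≤ v →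
      |youngIntegral f g 0 v - youngIntegral f g 0 u - f u * (g v - g u)| ≤
        C * (R * M) * (v - u) ^ (2 * α))
    (ha : ContinuousOn a (Icc 0 1)) (hb : ∀ i, HolderBdd α Λ (b i))
    (hB : ∀ i, HolderBdd α Λ (B i)) {u v : ℝ} (hu : u ∈ Icc (0 : ℝ) 1) (hv : v ∈ Icc (0 : ℝ) 1)
    (huv : u ≤ v) :
    |norrisPath a b B v - norrisPath a b B u - (∫ s in u..v, a s) -
      ∑ i, b i u * (B i v - B i u)| ≤ m * (C * Λ ^ 2 * (v - u) ^ (2 * α)) := by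
  have hi : ∀ x ∈ Icc (0 : ℝ) 1, ∀ y ∈ Icc (0 : ℝ) 1, IntervalIntegrable a volume x y :=
    fun x hx y hy => (ha.mono (ordConnected_Icc.uIcc_subset hx hy)).intervalIntegrable
  have h0 : (0 : ℝ) ∈ Icc (0 : ℝ) 1 := ⟨le_rfl, zero_le_one⟩
  have h1 := intervalIntegral.integral_add_adjacent_intervals (hi 0 h0 u hu) (hi u hu v hv)
  have e : norrisPath a b B v - norrisPath a b B u - (∫ s in u..v, a s) -
      ∑ i, b i u * (B i v - B i u) = ∑ i, (youngIntegral (b i) (B i) 0 v -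
        youngIntegral (b i) (B i) 0 u - b i u * (B i v - B i u)) := by
    simp only [norrisPath, Finset.sum_sub_distrib]
    linarith
  rw [e]
  refine (Finset.abs_sum_le_sum_abs _ _).trans ?_
  calc _ ≤ ∑ _i : Fin m, C * Λ ^ 2 * (v - u) ^ (2 * α) := by
        refine Finset.sum_le_sum fun i _ => ?_
        rw [sq]
        exact hC Λ Λ (b i) (B i) (hb i) (hB i) u hu v hv huv
    _ = _ := by simp

/-- The increment of y, the drift and the Young remainder over a length ε are all O(Λ² ε). Replacing
b(u) by a vector w close to b(t₀) costs a product of two factors O(Λ ε^α), again O(Λ² ε). The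
freedom in w is what later allows a deterministic direction. -/
theorem abs_sum_increment_le {α C Λ ε D : ℝ} (hα : 1 / 2 < α) (hα1 : α ≤ 1) (hC0 : 0 ≤ C) {m : ℕ}
    {a : ℝ → ℝ} {b B : Fin m → ℝ → ℝ}
    (hC : ∀ (R M : ℝ) (f g : ℝ → ℝ), HolderBdd α R f → HolderBdd α M g →
      ∀ u ∈ Icc (0 : ℝ) 1, ∀ v ∈ Icc (0 : ℝ) 1, u ≤ v →
      |youngIntegral f g 0 v - youngIntegral f g 0 u - f u * (g v - g u)| ≤
        C * (R * M) * (v - u) ^ (2 * α))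
    (hΛ : 1 ≤ Λ) (hε : 0 < ε) (hε1 : ε ≤ 1) (hD : 1 ≤ D)
    (ha : ContinuousOn a (Icc 0 1)) (haΛ : ∀ t ∈ Icc (0 : ℝ) 1, |a t| ≤ Λ)
    (hb : ∀ i, HolderBdd α Λ (b i)) (hB : ∀ i, HolderBdd α Λ (B i))
    (hy : ∀ t ∈ Icc (0 : ℝ) 1, |norrisPath a b B t| ≤ ε)
    {t₀ u : ℝ} (ht₀ : 0 ≤ t₀) (htu : t₀ ≤ u) (huD : u - t₀ ≤ D * ε) (hu1 : u + ε ≤ 1)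
    {w : Fin m → ℝ} (hw : ∀ i, |w i - b i t₀| ≤ ε) :
    |∑ i, w i * (B i (u + ε) - B i u)| ≤ (3 + m * (C + 1 + D)) * Λ ^ 2 * ε := by
  have mu : u ∈ Icc (0 : ℝ) 1 := ⟨ht₀.trans htu, by linarith⟩
  have mv : u + ε ∈ Icc (0 : ℝ) 1 := ⟨by linarith [mu.1], hu1⟩
  have mt : t₀ ∈ Icc (0 : ℝ) 1 := ⟨ht₀, by linarith [mu.2]⟩
  have hΛ0 : 0 < Λ := by linarith
  have hΛ2 : Λ ≤ Λ ^ 2 := by nlinarith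
  have hm : (0 : ℝ) ≤ m := by positivity
  have h1 := norrisPath_sub_le hC ha hb hB mu mv (by linarith)
  rw [add_sub_cancel_left] at h1
  have hε2 : ε ^ (2 * α) ≤ ε := by
    simpa using Real.rpow_le_rpow_of_exponent_ge hε hε1 (by linarith : (1 : ℝ) ≤ 2 * α)
  have hεα : ε ^ α * ε ^ α = ε ^ (2 * α) := by rw [← Real.rpow_add hε, two_mul]
  have hεα1 : ε ^ α ≤ 1 := Real.rpow_le_one hε.le hε1 (by linarith)
  have hintegral : |∫ s in u..u + ε, a s| ≤ Λ * ε := by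
    have := intervalIntegral.norm_integral_le_of_norm_le_const (a := u) (b := u + ε) (f := a)
      (C := Λ) (fun s hs => by
        rw [uIoc_of_le (by linarith)] at hs
        exact haΛ s ⟨by linarith [hs.1, mu.1], by linarith [hs.2]⟩)
    rwa [add_sub_cancel_left, abs_of_pos hε] at this
  have hbB : |∑ i, b i u * (B i (u + ε) - B i u)| ≤ 2 * ε + Λ * ε + m * (C * Λ ^ 2 * ε) := by
    have h3 : (m : ℝ) * (C * Λ ^ 2 * ε ^ (2 * α)) ≤ m * (C * Λ ^ 2 * ε) := by gcongr
    have h4 := abs_le.1 (hy u mu)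
    have h5 := abs_le.1 (hy (u + ε) mv)
    have h6 := abs_le.1 hintegral
    have h7 := abs_le.1 (h1.trans h3)
    rw [abs_le]
    constructor <;> linarith [h4.1, h4.2, h5.1, h5.2, h6.1, h6.2, h7.1, h7.2]
  have hdiff : ∀ i, |(w i - b i u) * (B i (u + ε) - B i u)| ≤ (1 + D) * Λ ^ 2 * ε := by
    intro i
    have hBi : |B i (u + ε) - B i u| ≤ Λ * ε ^ α := by
      simpa [abs_of_pos hε] using hB i u mu (u + ε) mv
    have hbi : |b i u - b i t₀| ≤ Λ * (D * ε ^ α) := by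
      refine (hb i t₀ mt u mu).trans ?_
      gcongr
      rw [abs_of_nonneg (by linarith)]
      calc (u - t₀) ^ α ≤ (D * ε) ^ α := by
            exact Real.rpow_le_rpow (by linarith) huD (by linarith)
        _ = D ^ α * ε ^ α := Real.mul_rpow (by linarith) hε.le
        _ ≤ D ^ (1 : ℝ) * ε ^ α := by gcongr
        _ = _ := by rw [Real.rpow_one]
    have hwb : |w i - b i u| ≤ ε + Λ * (D * ε ^ α) := by
      have := abs_sub_le (w i) (b i t₀) (b i u)
      rw [abs_sub_comm (b i t₀)] at this
      linarith [hw i]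
    rw [abs_mul]
    calc _ ≤ (ε + Λ * (D * ε ^ α)) * (Λ * ε ^ α) := by gcongr
      _ = Λ * ε * ε ^ α + D * Λ ^ 2 * (ε ^ α * ε ^ α) := by ring
      _ ≤ Λ ^ 2 * ε * 1 + D * Λ ^ 2 * ε := by rw [hεα]; gcongr
      _ = _ := by ring
  have hsum : ∑ i, w i * (B i (u + ε) - B i u) =
      ∑ i, b i u * (B i (u + ε) - B i u) + ∑ i, (w i - b i u) * (B i (u + ε) - B i u) := by
    rw [← Finset.sum_add_distrib]
    exact Finset.sum_congr rfl fun i _ => by ring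
  rw [hsum]
  have hsd : |∑ i, (w i - b i u) * (B i (u + ε) - B i u)| ≤ m * ((1 + D) * Λ ^ 2 * ε) := by
    refine (Finset.abs_sum_le_sum_abs _ _).trans ((Finset.sum_le_sum fun i _ => hdiff i).trans ?_)
    simp
  have hone : ε ≤ Λ ^ 2 * ε := le_mul_of_one_le_left hε.le (hΛ.trans hΛ2)
  have hΛε : Λ * ε ≤ Λ ^ 2 * ε := by gcongr
  calc _ ≤ (2 * ε + Λ * ε + m * (C * Λ ^ 2 * ε)) + m * ((1 + D) * Λ ^ 2 * ε) :=
        (abs_add_le _ _).trans (add_le_add hbB hsd)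
    _ ≤ (2 * (Λ ^ 2 * ε) + Λ ^ 2 * ε + m * (C * Λ ^ 2 * ε)) + m * ((1 + D) * Λ ^ 2 * ε) := by
        gcongr
    _ = _ := by ring

/-- Over a window of length h the drift equals a(s) h up to a Hölder error, and the remaining terms
are controlled by the bounds on y and b and by the Young remainder. -/
theorem abs_drift_mul_le {α C Λ ε θ h : ℝ} (hα : 1 / 2 < α) {m : ℕ}
    {a : ℝ → ℝ} {b B : Fin m → ℝ → ℝ}
    (hC : ∀ (R M : ℝ) (f g : ℝ → ℝ), HolderBdd α R f → HolderBdd α M g →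
      ∀ u ∈ Icc (0 : ℝ) 1, ∀ v ∈ Icc (0 : ℝ) 1, u ≤ v →
      |youngIntegral f g 0 v - youngIntegral f g 0 u - f u * (g v - g u)| ≤
        C * (R * M) * (v - u) ^ (2 * α))
    (hΛ : 0 ≤ Λ) (hh : 0 < h) (hh1 : h ≤ 1)
    (ha : ContinuousOn a (Icc 0 1)) (haΛ : HolderBdd α Λ a)
    (hb : ∀ i, HolderBdd α Λ (b i)) (hB : ∀ i, HolderBdd α Λ (B i))
    (hy : ∀ t ∈ Icc (0 : ℝ) 1, |norrisPath a b B t| ≤ ε)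
    (hbθ : ∀ t ∈ Icc (0 : ℝ) 1, ∀ i, |b i t| ≤ θ) {s : ℝ} (hs : s ∈ Icc (0 : ℝ) 1) :
    |a s| * h ≤ 2 * ε + m * (θ * (Λ * h ^ α)) + m * (C * Λ ^ 2 * h ^ (2 * α)) + Λ * h ^ α * h := by
  -- The window is pushed left when necessary so that it contains s and stays in [0,1].
  set u := min s (1 - h) with hu
  have hus : u ≤ s := min_le_left _ _
  have hu1 : u ≤ 1 - h := min_le_right _ _
  have hsu : s ≤ u + h := by
    rcases min_choice s (1 - h) with h' | h' <;> rw [hu, h'] <;> linarith [hs.2]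
  have mu : u ∈ Icc (0 : ℝ) 1 := ⟨le_min hs.1 (by linarith), by linarith⟩
  have mv : u + h ∈ Icc (0 : ℝ) 1 := ⟨by linarith [mu.1], by linarith⟩
  have h1 := norrisPath_sub_le hC ha hb hB mu mv (by linarith)
  rw [add_sub_cancel_left] at h1
  have hintegral : |(∫ x in u..u + h, a x) - a s * h| ≤ Λ * h ^ α * h := by
    have hi : IntervalIntegrable a volume u (u + h) :=
      (ha.mono (ordConnected_Icc.uIcc_subset mu mv)).intervalIntegrable
    have e : (∫ x in u..u + h, a x) - a s * h = ∫ x in u..u + h, (a x - a s) := by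
      rw [intervalIntegral.integral_sub hi (by simp)]
      simp [mul_comm]
    rw [e]
    have := intervalIntegral.norm_integral_le_of_norm_le_const (a := u) (b := u + h)
      (f := fun x => a x - a s) (C := Λ * h ^ α) (fun x hx => by
        rw [uIoc_of_le (by linarith)] at hx
        refine (haΛ s hs x ⟨by linarith [hx.1, mu.1], by linarith [hx.2, mv.2]⟩).trans ?_
        have : |x - s| ≤ h := by
          rw [abs_le]; constructor <;> linarith [hx.1, hx.2]
        gcongr)
    rwa [add_sub_cancel_left, abs_of_pos hh] at this
  have hsum : |∑ i, b i u * (B i (u + h) - B i u)| ≤ m * (θ * (Λ * h ^ α)) := by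
    refine (Finset.abs_sum_le_sum_abs _ _).trans ?_
    calc _ ≤ ∑ _i : Fin m, θ * (Λ * h ^ α) := by
          refine Finset.sum_le_sum fun i _ => ?_
          have hBi : |B i (u + h) - B i u| ≤ Λ * h ^ α := by
            simpa [abs_of_pos hh] using hB i u mu (u + h) mv
          have hbi := hbθ u mu i
          have := (abs_nonneg _).trans hbi
          rw [abs_mul]
          gcongr
      _ = _ := by simp
  have h4 := abs_le.1 (hy u mu)
  have h5 := abs_le.1 (hy (u + h) mv)
  have h6 := abs_le.1 hintegral
  have h7 := abs_le.1 h1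
  have h8 := abs_le.1 hsum
  rw [← abs_of_pos hh, ← abs_mul, abs_of_pos hh, abs_le]
  constructor <;>
    linarith [h4.1, h4.2, h5.1, h5.2, h6.1, h6.2, h7.1, h7.2, h8.1, h8.2]

set_option maxHeartbeats 1000000 in
/-- On paths with controlled Hölder constants, either the conclusion of the Norris lemma holds or
many increments of a discretised linear combination of the driving paths are small. -/
theorem norris_dichotomy {α κ β C : ℝ} (hα : 1 / 2 < α) (hα1 : α ≤ 1) (hκ : 0 < κ) (hκ1 : κ ≤ 1)
    (h7 : 7 * κ ≤ β * α) (h8 : 8 * κ ≤ β * (2 * α - 1)) (h6 : 6 * κ + β ≤ 1)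
    (hab : 0 < α - κ - β) (hκβ : κ < β) (hC0 : 0 ≤ C)
    (hC : ∀ (R M : ℝ) (f g : ℝ → ℝ), HolderBdd α R f → HolderBdd α M g →
      ∀ u ∈ Icc (0 : ℝ) 1, ∀ v ∈ Icc (0 : ℝ) 1, u ≤ v →
      |youngIntegral f g 0 v - youngIntegral f g 0 u - f u * (g v - g u)| ≤
        C * (R * M) * (v - u) ^ (2 * α)) (m K L : ℕ) :
    ∀ᶠ ε : ℝ in 𝓝[>] 0, ∀ (a : ℝ → ℝ) (b B : Fin m → ℝ → ℝ), ContinuousOn a (Icc 0 1) →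
      HolderBdd α (ε ^ (-κ)) a → (∀ t ∈ Icc (0 : ℝ) 1, |a t| ≤ ε ^ (-κ)) →
      (∀ i, HolderBdd α (ε ^ (-κ)) (b i)) → (∀ i, ∀ t ∈ Icc (0 : ℝ) 1, |b i t| ≤ ε ^ (-κ)) →
      (∀ i, HolderBdd α (ε ^ (-κ)) (B i)) →
      (∀ t ∈ Icc (0 : ℝ) 1, |norrisPath a b B t| ≤ ε) →
      (∀ t ∈ Icc (0 : ℝ) 1, |a t| ≤ ε ^ κ / 2 ∧ ∑ i, |b i t| ≤ ε ^ κ / 2) ∨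
      ∃ k ∈ Finset.range (⌈1 / ε⌉₊ + 2),
        ∃ z ∈ Fintype.piFinset fun _ : Fin m => Finset.Icc (-⌈2 / ε ^ 2⌉) ⌈2 / ε ^ 2⌉,
        0 < k ∧ k * ε + K * L * ε + ε < 1 ∧ (∃ i, ε ^ β ≤ |ε * z i|) ∧
        ∀ j : Fin K, |∑ i, ε * z i * (B i (k * ε + j * L * ε + ε) - B i (k * ε + j * L * ε))| ≤
          ε ^ (1 - 3 * κ) := by
  -- In units of ε, D bounds the distance from the chosen grid time both to t and to the times of
  -- the K increments.
  set D : ℝ := K * L + 4 with hD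
  have hKL : (0 : ℝ) ≤ K * L := by positivity
  have hβ : 0 < β := hκ.trans hκβ
  have hlt1 : ∀ᶠ ε : ℝ in 𝓝[>] 0, ε < 1 :=
    (eventually_lt_nhds one_pos).filter_mono nhdsWithin_le_nhds
  filter_upwards [self_mem_nhdsWithin, hlt1,
    eventually_mul_rpow_le_one (3 + m * (C + 1 + D)) hκ,
    eventually_mul_rpow_le_one (D + 1) hab,
    eventually_mul_rpow_le_one D one_pos,
    eventually_mul_rpow_le_one (2 * (m * 2)) (by linarith : 0 < β - κ),
    eventually_mul_rpow_le_one (2 * (2 + m * 2 + m * C + 1)) (by linarith : 0 < 5 * κ)]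
    with ε hε hε1 F1 F2 F3 F7 F8
  replace hε : 0 < ε := hε
  intro a b B ha haH haΛ hbH hbΛ hBH hy
  have hm : (0 : ℝ) ≤ m := by positivity
  rw [Real.rpow_one] at F3
  have hp : ∀ {x y : ℝ}, x ≤ y → ε ^ y ≤ ε ^ x := fun h =>
    Real.rpow_le_rpow_of_exponent_ge hε hε1.le h
  set Λ : ℝ := ε ^ (-κ) with hΛdef
  have hΛ : 1 ≤ Λ := by simpa using hp (by linarith : -κ ≤ 0)
  have hΛ0 : 0 < Λ := by linarith
  by_cases hbig : ∃ t ∈ Icc (0 : ℝ) 1, ∃ i, 2 * ε ^ β < |b i t|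
  · right
    obtain ⟨t, ht, i, hi⟩ := hbig
    -- Moving back from time 1 leaves room for the K blocks even after rounding up to the grid.
    set t' := min t (1 - (K * L + 3) * ε) with ht'
    have ht'0 : 0 ≤ t' := le_min ht.1 (by rw [hD] at F3; nlinarith)
    have ht't : t' ≤ t := min_le_left _ _
    have ht'1 : t' ≤ 1 - (K * L + 3) * ε := min_le_right _ _
    have htt' : t - t' ≤ (K * L + 3) * ε := by
      have h0 : 0 ≤ (K * L + 3 : ℝ) * ε := by positivity
      rcases min_choice t (1 - (K * L + 3) * ε) with h' | h' <;> rw [ht', h'] <;>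
        linarith [ht.2]
    -- The added 1 makes k positive, so that all times lie in the open interval where the type-H
    -- bounds hold.
    set k := ⌊t' / ε⌋₊ + 1 with hk
    have hfl : (⌊t' / ε⌋₊ : ℝ) * ε ≤ t' := by
      have := Nat.floor_le (div_nonneg ht'0 hε.le)
      rwa [le_div_iff₀ hε] at this
    have hfu : t' < k * ε := by
      have := Nat.lt_floor_add_one (t' / ε)
      rw [div_lt_iff₀ hε] at this
      simpa [hk] using this
    have hku : (k : ℝ) * ε ≤ t' + ε := by rw [hk]; push_cast; linarith
    set t₀ : ℝ := k * ε with ht₀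
    have ht₀0 : 0 ≤ t₀ := by positivity
    have ht₀1 : t₀ + K * L * ε + ε < 1 := by linarith
    have mt₀ : t₀ ∈ Icc (0 : ℝ) 1 :=
      ⟨ht₀0, by have : 0 ≤ K * L * ε := by positivity
                linarith⟩
    have hdist : |t - t₀| ≤ D * ε := by
      have : 0 ≤ K * L * ε := by positivity
      rw [abs_le, hD]; constructor <;> linarith
    -- Rounding to the lattice of mesh ε. Since |b^i| ≤ Λ ≤ 1/ε, the integers are at most 2/ε² in
    -- modulus.
    set z : Fin m → ℤ := fun i => ⌊b i t₀ / ε⌋ with hz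
    have hzb : ∀ i, |ε * z i - b i t₀| ≤ ε := by
      intro i
      have h1 := Int.floor_le (b i t₀ / ε)
      have h2 := Int.lt_floor_add_one (b i t₀ / ε)
      rw [le_div_iff₀ hε] at h1
      rw [div_lt_iff₀ hε] at h2
      rw [abs_le]
      constructor <;> simp only [hz] <;> linarith
    have hΛε : Λ ≤ 1 / ε := by
      rw [one_div, ← Real.rpow_neg_one]
      exact hp (by linarith)
    refine ⟨k, ?_, z, ?_, Nat.succ_pos _, ht₀1, ⟨i, ?_⟩, fun j => ?_⟩
    · rw [Finset.mem_range, hk]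
      have : ⌊t' / ε⌋₊ ≤ ⌈1 / ε⌉₊ := by
        refine (Nat.floor_mono ?_).trans (Nat.floor_le_ceil _)
        have : t' ≤ 1 := ht't.trans ht.2
        gcongr
      omega
    · rw [Fintype.mem_piFinset]
      intro i
      have h1 : |(z i : ℝ)| ≤ 2 / ε ^ 2 := by
        have h2 : |ε * z i| ≤ 2 / ε := by
          have := abs_sub_abs_le_abs_sub (ε * z i) (b i t₀)
          have h3 := hzb i
          have h4 := hbΛ i t₀ mt₀
          have h5 : ε ≤ 1 / ε := by
            rw [le_div_iff₀ hε]; nlinarith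
          have h6 : 2 / ε = 1 / ε + 1 / ε := by ring
          linarith
        rw [abs_mul, abs_of_pos hε] at h2
        rw [le_div_iff₀ hε] at h2
        rw [le_div_iff₀ (by positivity)]
        nlinarith
      have h2 := abs_le.1 h1
      rw [Finset.mem_Icc]
      have h3 := Int.le_ceil (2 / ε ^ 2)
      constructor
      · have : (-⌈2 / ε ^ 2⌉ : ℝ) ≤ z i := by linarith
        exact_mod_cast this
      · have : (z i : ℝ) ≤ ⌈2 / ε ^ 2⌉ := by linarith
        exact_mod_cast this
    -- From t to t₀ and through the rounding b^i changes by at most (D + 1) ε^(α-κ) ≤ ε^β, so the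
    -- threshold 2ε^β at t leaves ε^β for the lattice vector.
    · have h1 : |b i t - b i t₀| ≤ D * ε ^ (α - κ) := by
        refine (hbH i t₀ mt₀ t ht).trans ?_
        calc Λ * |t - t₀| ^ α ≤ Λ * (D * ε) ^ α := by gcongr
          _ = Λ * (D ^ α * ε ^ α) := by rw [Real.mul_rpow (by linarith) hε.le]
          _ ≤ Λ * (D ^ (1 : ℝ) * ε ^ α) := by
              gcongr
              linarith
          _ = D * ε ^ (α - κ) := by
              rw [Real.rpow_one, sub_eq_add_neg, Real.rpow_add hε]; ring
      have h2 : ε ≤ ε ^ (α - κ) := by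
        simpa using hp (by linarith : α - κ ≤ 1)
      have h3 : (D + 1) * ε ^ (α - κ) ≤ ε ^ β := by
        have e : ε ^ (α - κ) = ε ^ (α - κ - β) * ε ^ β := by
          rw [← Real.rpow_add hε]; congr 1; ring
        rw [e, ← mul_assoc]
        exact mul_le_of_le_one_left (by positivity) F2
      have h4 := hzb i
      have h5 := abs_sub_abs_le_abs_sub (b i t) (ε * z i)
      have h6 := abs_sub_le (b i t) (b i t₀) (ε * z i)
      rw [abs_sub_comm (b i t₀)] at h6
      linarith
    · have hjK : (j : ℝ) ≤ K := by exact_mod_cast j.2.le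
      have hj0 : 0 ≤ (j : ℝ) * L * ε := by positivity
      have hjL : (j : ℝ) * L * ε ≤ K * L * ε := by gcongr
      refine (abs_sum_increment_le (D := D) hα hα1 hC0 hC hΛ hε hε1.le (by linarith) ha haΛ hbH hBH
        hy ht₀0 (by linarith : t₀ ≤ t₀ + j * L * ε) (by rw [hD]; linarith) (by linarith)
        hzb).trans ?_
      -- The exponent 1 - 3κ, rather than 1 - 2κ, leaves a factor ε^κ that absorbs the constant.
      have e : Λ ^ 2 * ε = ε ^ (1 - 3 * κ) * ε ^ κ := by
        rw [hΛdef, ← Real.rpow_natCast, ← Real.rpow_mul hε.le, ← Real.rpow_add hε]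
        nth_rewrite 2 [← Real.rpow_one ε]
        rw [← Real.rpow_add hε]
        congr 1
        push_cast
        ring
      rw [mul_assoc, e, mul_left_comm]
      exact mul_le_of_le_one_right (by positivity) F1
  · left
    push Not at hbig
    intro t ht
    constructor
    -- With |b^i| ≤ 2ε^β and window length ε^β, every error is O(ε^(6κ+β)). The surplus ε^(5κ)
    -- absorbs the constants, and dividing by h leaves ε^κ / 2.
    · set h := ε ^ β with hh
      have hh0 : 0 < h := by positivity
      have hh1 : h ≤ 1 := Real.rpow_le_one hε.le hε1.le hβ.le
      have hmain := abs_drift_mul_le hα hC hΛ0.le hh0 hh1 ha haH hbH hBH hy hbig ht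
      have hpow : ∀ x : ℝ, h ^ x = ε ^ (β * x) := fun x => by rw [hh, ← Real.rpow_mul hε.le]
      have hT : ε ^ (6 * κ + β) = ε ^ (5 * κ) * (ε ^ κ * h) := by
        rw [hh, ← Real.rpow_add hε, ← Real.rpow_add hε]; congr 1; ring
      have T1 : ε ≤ ε ^ (6 * κ + β) := by simpa using hp h6
      have T2 : h * (Λ * h ^ α) ≤ ε ^ (6 * κ + β) := by
        rw [hpow, hh, hΛdef, ← Real.rpow_add hε, ← Real.rpow_add hε]
        exact hp (by linarith)
      have T3 : Λ ^ 2 * h ^ (2 * α) ≤ ε ^ (6 * κ + β) := by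
        rw [hpow, hΛdef, ← Real.rpow_natCast, ← Real.rpow_mul hε.le, ← Real.rpow_add hε]
        refine hp ?_
        push_cast
        linarith
      have hsum : 2 * ε + m * (2 * h * (Λ * h ^ α)) + m * (C * Λ ^ 2 * h ^ (2 * α)) +
          Λ * h ^ α * h ≤ (2 + m * 2 + m * C + 1) * ε ^ (6 * κ + β) := by
        have a1 : (m : ℝ) * 2 * (h * (Λ * h ^ α)) ≤ m * 2 * ε ^ (6 * κ + β) := by gcongr
        have a2 : (m : ℝ) * C * (Λ ^ 2 * h ^ (2 * α)) ≤ m * C * ε ^ (6 * κ + β) := by gcongr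
        linarith
      have hfin : |a t| * h ≤ (ε ^ κ / 2) * h := by
        refine (hmain.trans hsum).trans ?_
        rw [hT]
        have hq : 0 ≤ ε ^ κ * h := by positivity
        calc _ = (2 * (2 + m * 2 + m * C + 1) * ε ^ (5 * κ)) * (ε ^ κ * h) / 2 := by ring
          _ ≤ 1 * (ε ^ κ * h) / 2 := by gcongr
          _ = _ := by ring
      exact le_of_mul_le_mul_right hfin hh0
    · calc ∑ i, |b i t| ≤ ∑ _i : Fin m, 2 * ε ^ β := Finset.sum_le_sum fun i _ => hbig t ht i
        _ = (2 * (m * 2) * ε ^ (β - κ)) * ε ^ κ / 2 := by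
            rw [mul_assoc, ← Real.rpow_add hε]
            simp
            ring
        _ ≤ 1 * ε ^ κ / 2 := by gcongr
        _ = _ := by ring

/-! ### Union bound and conclusion -/

/-- Failure for all Λ is contained in failure at Λ = n + 1, whose outer measure tends to zero; no
measurability of Q is needed. -/
theorem ae_exists_of_tail {Ω : Type*} [MeasurableSpace Ω] {P : Measure Ω} {Q : ℝ → Ω → Prop}
    {C : ℝ} (h : ∀ Λ : ℝ, 1 ≤ Λ → P {ω | ¬ Q Λ ω} ≤ ENNReal.ofReal (C * Λ ^ (-1 : ℝ))) :
    ∀ᵐ ω ∂P, ∃ Λ, Q Λ ω := by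
  have hlim : Tendsto (fun n : ℕ => ENNReal.ofReal (C * ((n : ℝ) + 1) ^ (-1 : ℝ))) atTop (𝓝 0) := by
    have h1 := tendsto_one_div_add_atTop_nhds_zero_nat (𝕜 := ℝ)
    have h2 := ENNReal.tendsto_ofReal (h1.const_mul C)
    simpa [Real.rpow_neg_one] using h2
  have hle : ∀ n : ℕ, P {ω | ¬ ∃ Λ, Q Λ ω} ≤ ENNReal.ofReal (C * ((n : ℝ) + 1) ^ (-1 : ℝ)) :=
    fun n => (measure_mono (t := {ω | ¬ Q ((n : ℝ) + 1) ω}) fun ω hω hQ =>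
      (hω : ¬ ∃ Λ, Q Λ ω) ⟨_, hQ⟩).trans
      (h ((n : ℝ) + 1) (by have : (0 : ℝ) ≤ n := by positivity
                           linarith))
  exact le_antisymm (ge_of_tendsto' hlim hle) (zero_le)

theorem abs_le_of_supNorm_lt {f : ℝ → ℝ} {ε : ℝ} (hε : 0 < ε) (h : supNorm f < ENNReal.ofReal ε) :
    ∀ t ∈ Icc (0 : ℝ) 1, |f t| ≤ ε := by
  intro t ht
  have h1 : ‖f t‖ₑ < ENNReal.ofReal ε :=
    (le_iSup₂ (f := fun t (_ : t ∈ Icc (0 : ℝ) 1) => ‖f t‖ₑ) t ht).trans_lt h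
  rw [Real.enorm_eq_ofReal_abs] at h1
  exact ((ENNReal.ofReal_lt_ofReal_iff hε).1 h1).le

theorem supNorm_le_ofReal {E : Type*} [NormedAddCommGroup E] {f : ℝ → E} {x : ℝ}
    (h : ∀ t ∈ Icc (0 : ℝ) 1, ‖f t‖ ≤ x) : supNorm f ≤ ENNReal.ofReal x :=
  iSup₂_le fun t ht => by
    rw [← ofReal_norm]
    exact ENNReal.ofReal_le_ofReal (h t ht)

theorem EuclideanSpace.norm_le_sum_abs {m : ℕ} (x : EuclideanSpace ℝ (Fin m)) :
    ‖x‖ ≤ ∑ i, |x i| := by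
  have h0 : 0 ≤ ∑ i, |x i| := Finset.sum_nonneg fun i _ => abs_nonneg _
  rw [EuclideanSpace.norm_eq]
  refine Real.sqrt_le_iff.2 ⟨h0, ?_⟩
  simp only [Real.norm_eq_abs]
  exact Finset.sum_sq_le_sq_sum_of_nonneg fun i _ => abs_nonneg _

theorem card_grid_le {ε : ℝ} (hε : 0 < ε) (hε1 : ε < 1) :
    ((⌈1 / ε⌉₊ + 2 : ℕ) : ℝ) ≤ 4 / ε := by
  have h1 := Nat.ceil_lt_add_one (by positivity : 0 ≤ 1 / ε)
  have h2 : 1 ≤ 1 / ε := by rw [le_div_iff₀ hε]; linarith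
  have h3 : 4 / ε = 4 * (1 / ε) := by ring
  push_cast
  linarith

theorem card_net_le {ε : ℝ} (hε : 0 < ε) (hε1 : ε < 1) (m : ℕ) :
    ((Fintype.piFinset fun _ : Fin m => Finset.Icc (-⌈2 / ε ^ 2⌉) ⌈2 / ε ^ 2⌉).card : ℝ) ≤
      (7 / ε ^ 2) ^ m := by
  rw [Fintype.card_piFinset, Finset.prod_const, Finset.card_univ, Fintype.card_fin]
  push_cast
  gcongr
  rw [Int.card_Icc]
  have hc0 : 0 ≤ ⌈2 / ε ^ 2⌉ := Int.ceil_nonneg (by positivity)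
  have h1 := Int.ceil_lt_add_one (2 / ε ^ 2)
  have h2 : 1 ≤ 1 / ε ^ 2 := by rw [le_div_iff₀ (by positivity)]; nlinarith
  have e : (((⌈2 / ε ^ 2⌉ + 1 - -⌈2 / ε ^ 2⌉).toNat : ℕ) : ℝ) =
      ((⌈2 / ε ^ 2⌉ + 1 - -⌈2 / ε ^ 2⌉ : ℤ) : ℝ) := by
    rw [← Int.cast_natCast, Int.toNat_of_nonneg (by omega)]
  rw [e]
  push_cast
  have h3 : 7 / ε ^ 2 = 7 * (1 / ε ^ 2) := by ring
  have h4 : 2 / ε ^ 2 = 2 * (1 / ε ^ 2) := by ring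
  linarith

theorem measure_iUnion_le_sum_ofReal {Ω ι : Type*} [Fintype ι] [MeasurableSpace Ω] {P : Measure Ω}
    {E : ι → Set Ω} {c : ι → ℝ} (hc : ∀ i, 0 ≤ c i) (h : ∀ i, P (E i) ≤ ENNReal.ofReal (c i)) :
    P (⋃ i, E i) ≤ ENNReal.ofReal (∑ i, c i) := by
  refine (measure_iUnion_fintype_le P E).trans ?_
  rw [ENNReal.ofReal_sum_of_nonneg fun i _ => hc i]
  exact Finset.sum_le_sum fun i _ => h i

set_option maxHeartbeats 1000000 in
/-- The union bound over a time grid and a net of directions in the small ball estimate. -/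
theorem smallBall_union {Ω : Type*} [MeasurableSpace Ω] (P : Measure Ω)
    [IsProbabilityMeasure P] {H : ℝ} (hH1 : H < 1) {m : ℕ} (B : Fin m → ℝ → Ω → ℝ)
    (hB_meas : ∀ i, ∀ t ∈ Icc (0 : ℝ) 1, Measurable (B i t))
    (hB_type : ∀ i, IsGaussianOfType P H (B i))
    (hB_indep : iIndepFun (fun i ω (t : Icc (0 : ℝ) 1) => B i t ω) P) {κ β : ℝ}
    (hρ : 0 < 1 - 3 * κ - (β + H)) (p : ℝ) :
    ∃ (K L : ℕ) (C : ℝ), 0 < C ∧ ∀ ε : ℝ, 0 < ε → ε < 1 →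
      P {ω | ∃ k ∈ Finset.range (⌈1 / ε⌉₊ + 2),
        ∃ z ∈ Fintype.piFinset fun _ : Fin m => Finset.Icc (-⌈2 / ε ^ 2⌉) ⌈2 / ε ^ 2⌉,
        0 < k ∧ k * ε + K * L * ε + ε < 1 ∧ (∃ i, ε ^ β ≤ |ε * z i|) ∧
        ∀ j : Fin K, |∑ i, ε * z i * (B i (k * ε + j * L * ε + ε) ω - B i (k * ε + j * L * ε) ω)| ≤
          ε ^ (1 - 3 * κ)} ≤ ENNReal.ofReal (C * ε ^ p) := by
  set ρ := 1 - 3 * κ - (β + H) with hρdef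
  obtain ⟨c, hc, hsb⟩ := smallBall_increments P hH1 B hB_meas hB_type hB_indep
  -- There are O(1/ε) grid times and O(ε^(-2m)) lattice directions, each contributing O(ε^(ρK)), so
  -- ρK must reach p + 1 + 2m.
  set K := ⌈(p + 1 + 2 * m) / ρ⌉₊ with hK
  obtain ⟨L, hL⟩ := hsb K
  have hKρ : p + 1 + 2 * m ≤ ρ * K := by
    have := Nat.le_ceil ((p + 1 + 2 * m) / ρ)
    rw [div_le_iff₀ hρ] at this
    linarith
  refine ⟨K, L, 4 * 7 ^ m * c ^ K, by positivity, fun ε hε hε1 => ?_⟩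
  set Z := Fintype.piFinset fun _ : Fin m => Finset.Icc (-⌈2 / ε ^ 2⌉) ⌈2 / ε ^ 2⌉ with hZ
  set S : ℕ → (Fin m → ℤ) → Set Ω := fun k z => {ω | 0 < k ∧ k * ε + K * L * ε + ε < 1 ∧
    (∃ i, ε ^ β ≤ |ε * z i|) ∧ ∀ j : Fin K, |∑ i, ε * z i *
      (B i (k * ε + j * L * ε + ε) ω - B i (k * ε + j * L * ε) ω)| ≤ ε ^ (1 - 3 * κ)} with hS
  have hSP : ∀ k z, P (S k z) ≤ ENNReal.ofReal ((c * ε ^ ρ) ^ K) := by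
    intro k z
    by_cases hcond : 0 < k ∧ k * ε + K * L * ε + ε < 1 ∧ ∃ i, ε ^ β ≤ |ε * z i|
    · obtain ⟨hk, h1, hz⟩ := hcond
      have hk' : (0 : ℝ) < k := by exact_mod_cast hk
      have h := hL (k * ε) ε (by positivity) hε h1 (fun i => ε * z i) (ε ^ β) (ε ^ (1 - 3 * κ))
        (by positivity) (by positivity) hz
      have e : ε ^ (1 - 3 * κ) / (ε ^ β * ε ^ H) = ε ^ ρ := by
        rw [← Real.rpow_add hε, ← Real.rpow_sub hε]
      rw [e] at h
      exact (measure_mono fun ω hω => hω.2.2.2).trans h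
    · have : S k z = ∅ := by
        ext ω
        simp only [hS, mem_ofPred_eq, mem_empty_iff_false, iff_false]
        exact fun hω => hcond ⟨hω.1, hω.2.1, hω.2.2.1⟩
      rw [this, measure_empty]
      exact zero_le
  have hcover : {ω | ∃ k ∈ Finset.range (⌈1 / ε⌉₊ + 2), ∃ z ∈ Z,
        0 < k ∧ k * ε + K * L * ε + ε < 1 ∧ (∃ i, ε ^ β ≤ |ε * z i|) ∧
        ∀ j : Fin K, |∑ i, ε * z i * (B i (k * ε + j * L * ε + ε) ω - B i (k * ε + j * L * ε) ω)| ≤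
          ε ^ (1 - 3 * κ)} ⊆ ⋃ k ∈ Finset.range (⌈1 / ε⌉₊ + 2), ⋃ z ∈ Z, S k z := by
    rintro ω ⟨k, hk, z, hz, h⟩
    exact mem_biUnion hk (mem_biUnion hz h)
  refine (measure_mono hcover).trans ?_
  calc _ ≤ ∑ _k ∈ Finset.range (⌈1 / ε⌉₊ + 2), ∑ _z ∈ Z, ENNReal.ofReal ((c * ε ^ ρ) ^ K) :=
        (measure_biUnion_finset_le _ _).trans (Finset.sum_le_sum fun k _ =>
          (measure_biUnion_finset_le _ _).trans (Finset.sum_le_sum fun z _ => hSP k z))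
    _ = ENNReal.ofReal (((⌈1 / ε⌉₊ + 2 : ℕ) : ℝ) * (Z.card * (c * ε ^ ρ) ^ K)) := by
        rw [Finset.sum_const, Finset.sum_const, Finset.card_range, nsmul_eq_mul, nsmul_eq_mul,
          ENNReal.ofReal_mul (by positivity), ENNReal.ofReal_mul (by positivity),
          ENNReal.ofReal_natCast, ENNReal.ofReal_natCast]
    _ ≤ ENNReal.ofReal (4 / ε * ((7 / ε ^ 2) ^ m * (c * ε ^ ρ) ^ K)) := by
        refine ENNReal.ofReal_le_ofReal ?_
        have := card_grid_le hε hε1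
        have := card_net_le hε hε1 m
        gcongr
    _ ≤ _ := by
        refine ENNReal.ofReal_le_ofReal ?_
        have e1 : (ε ^ ρ) ^ K = ε ^ (ρ * K) := by
          rw [← Real.rpow_natCast, ← Real.rpow_mul hε.le]
        have e2 : (ε ^ 2) ^ m = ε ^ (2 * m : ℝ) := by
          rw [← pow_mul, ← Real.rpow_natCast]; push_cast; rfl
        have e3 : ε ^ (ρ * K - 1 - 2 * m) = ε ^ (ρ * K) / ε / ε ^ (2 * m : ℝ) := by
          rw [Real.rpow_sub hε, Real.rpow_sub hε, Real.rpow_one]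
        calc _ = 4 * 7 ^ m * c ^ K * ε ^ (ρ * K - 1 - 2 * m) := by
              rw [mul_pow, div_pow, e1, e2, e3]
              field_simp
          _ ≤ _ := by
              gcongr 4 * 7 ^ m * c ^ K * ?_
              exact Real.rpow_le_rpow_of_exponent_ge hε hε1.le (by linarith)

set_option maxHeartbeats 1000000 in
theorem mainTheorem2 {Ω : Type*} [MeasurableSpace Ω] (P : Measure Ω) [IsProbabilityMeasure P]
    (H : ℝ) (hH : 1 / 2 < H) (hH1 : H < 1) (m : ℕ)
    -- `m` i.i.d. Gaussian processes of type `H` with almost surely continuous paths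
    (B : Fin m → ℝ → Ω → ℝ)
    (hB_meas : ∀ i, ∀ t ∈ Icc (0 : ℝ) 1, Measurable (B i t))
    (hB_cont : ∀ i, ∀ᵐ ω ∂P, ContinuousOn (fun t => B i t ω) (Icc 0 1))
    (hB_type : ∀ i, IsGaussianOfType P H (B i))
    (hB_indep : iIndepFun (fun i ω (t : Icc (0 : ℝ) 1) => B i t ω) P)
    (hB_ident : ∀ i j, IdentDistrib (fun ω (t : Icc (0 : ℝ) 1) => B i t ω)
      (fun ω (t : Icc (0 : ℝ) 1) => B j t ω) P P)
    -- processes `a` and `b` whose Hölder norms have moments of all orders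
    (a : ℝ → Ω → ℝ) (b : ℝ → Ω → EuclideanSpace ℝ (Fin m))
    (ha_meas : ∀ t ∈ Icc (0 : ℝ) 1, AEMeasurable (a t) P)
    (hb_meas : ∀ t ∈ Icc (0 : ℝ) 1, AEMeasurable (b t) P)
    (ha_cont : ∀ᵐ ω ∂P, ContinuousOn (fun t => a t ω) (Icc 0 1))
    (hb_cont : ∀ᵐ ω ∂P, ContinuousOn (fun t => b t ω) (Icc 0 1))
    (hab : ∀ p : ℝ, 1 ≤ p → ∀ H' : ℝ≥0, 1 / 2 < (H' : ℝ) → (H' : ℝ) < H →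
      ∫⁻ ω, (holderNorm H' (fun t => a t ω) +
        ∑ i, holderNorm H' (fun t => b t ω i)) ^ p ∂P < ∞) :
    -- the stochastic integrals defining `y` exist almost surely
    (∀ᵐ ω ∂P, ∀ i, ∀ t ∈ Icc (0 : ℝ) 1,
      ∃ J, HasYoungIntegral (fun s => b s ω i) (fun s => B i s ω) 0 t J) ∧
    ∃ q : ℝ, 0 < q ∧ ∀ p : ℝ, 0 < p → ∃ C : ℝ, 0 < C ∧ ∀ ε : ℝ, 0 < ε →
      P {ω | supNorm (fun t => norrisProcess a b B t ω) < ENNReal.ofReal ε ∧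
          ENNReal.ofReal (ε ^ q) < supNorm (fun t => a t ω) + supNorm (fun t => b t ω)} <
        ENNReal.ofReal (C * ε ^ p) := by
  -- α is the midpoint of (1/2, H); β < 1 - H leaves a positive small ball exponent; κ makes 8κ ≤
  -- β(2α - 1) an equality, and the other constraints then hold.
  set α : ℝ := (1 / 2 + H) / 2 with hα
  set β : ℝ := (1 - H) / 4 with hβ
  set κ : ℝ := (1 - H) * (2 * H - 1) / 64 with hκ
  have hα2 : 1 / 2 < α := by linarith
  have hαH : α < H := by linarith
  have hα1 : α ≤ 1 := by linarith
  have hκ0 : 0 < κ := by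
    have : 0 < (1 - H) * (2 * H - 1) := mul_pos (by linarith) (by linarith)
    linarith
  have hκle : κ ≤ (1 - H) / 64 := by
    have : (1 - H) * (2 * H - 1) ≤ (1 - H) * 1 := by gcongr; linarith
    linarith
  have hβ0 : 0 < β := by linarith
  obtain ⟨C, hC0, hY⟩ := young_loeve hα2 hα1
  set r : ℝ≥0 := ⟨α, by linarith⟩ with hr
  have hmom : ∀ p : ℝ, 1 ≤ p → ∫⁻ ω, (holderNorm r (fun t => a t ω) +
      ∑ i, holderNorm r (fun t => b t ω i)) ^ p ∂P < ∞ := fun p hp => hab p hp r hα2 hαH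
  have hcont_bi : ∀ i, ∀ᵐ ω ∂P, ContinuousOn (fun t => b t ω i) (Icc 0 1) := fun i => by
    filter_upwards [hb_cont] with ω hω
    exact (EuclideanSpace.proj (𝕜 := ℝ) i).continuous.comp_continuousOn hω
  have hmeas_bi : ∀ i, ∀ t ∈ Icc (0 : ℝ) 1, AEMeasurable (fun ω => b t ω i) P := fun i t ht =>
    (EuclideanSpace.proj (𝕜 := ℝ) i).continuous.measurable.comp_aemeasurable (hb_meas t ht)
  have ta := fun p => holder_sup_tail ha_meas ha_cont (r := r) (fun p hp =>
    (lintegral_mono fun ω => ENNReal.rpow_le_rpow (le_add_right le_rfl) (by linarith)).trans_lt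
      (hmom p hp)) p
  have tb := fun p i => holder_sup_tail (X := fun t ω => b t ω i) (hmeas_bi i) (hcont_bi i) (r := r)
    (fun p hp => (lintegral_mono fun ω => ENNReal.rpow_le_rpow
      ((Finset.single_le_sum (f := fun i => holderNorm r (fun t => b t ω i))
        (fun _ _ => zero_le) (Finset.mem_univ i)).trans (le_add_left le_rfl))
      (by linarith)).trans_lt (hmom p hp)) p
  have tB := fun p i => (hB_type i).holder_tail (by linarith : 0 < α) hαH (hB_cont i) (p := p)
  refine ⟨?_, κ, hκ0, fun p hp => ?_⟩
  · rw [ae_all_iff]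
    intro i
    obtain ⟨C₁, -, h₁⟩ := tb 1 i
    obtain ⟨C₂, -, h₂⟩ := tB 1 i
    filter_upwards [ae_exists_of_tail h₁, ae_exists_of_tail h₂] with ω hω₁ hω₂
    obtain ⟨R, hR, -⟩ := hω₁
    obtain ⟨M, hM⟩ := hω₂
    exact (hY R M _ _ hR hM).1
  -- Tails of order p/κ, because Λ = ε^(-κ) turns Λ^(-p/κ) into ε^p.
  obtain ⟨Ca, hCa, hta⟩ := ta (p / κ)
  choose Cb hCb htb using tb (p / κ)
  choose CB hCB htB using tB (p / κ)
  obtain ⟨K, L, CS, hCS, hSU⟩ := smallBall_union P hH1 B hB_meas hB_type hB_indep (κ := κ) (β := β)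
    (by linarith) p
  have hdich := norris_dichotomy hα2 hα1 hκ0 (by linarith) (β := β)
    (by have : β * (1 / 2) ≤ β * α := by gcongr
        linarith)
    (le_of_eq (by rw [hκ, hβ, hα]; ring)) (by linarith) (by linarith) (by linarith) hC0.le
    (fun R M f g hf hg => (hY R M f g hf hg).2) m K L
  obtain ⟨ε₀, hε₀, hsub⟩ := mem_nhdsGT_iff_exists_Ioo_subset.1 hdich
  set ε₁ := min ε₀ 1 with hε₁
  have hε₁0 : 0 < ε₁ := lt_min hε₀ one_pos
  have hsb : 0 ≤ ∑ i, Cb i := Finset.sum_nonneg fun i _ => (hCb i).le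
  have hsB : 0 ≤ ∑ i, CB i := Finset.sum_nonneg fun i _ => (hCB i).le
  set Ct : ℝ := Ca + ∑ i, Cb i + ∑ i, CB i + CS with hCt
  have hCt0 : 0 < Ct := by positivity
  -- The last term covers ε ≥ ε₁, where the trivial bound 1 on the probability is used; the surplus
  -- over `Ct` makes the final inequality strict.
  refine ⟨Ct + 1 + 2 * ε₁ ^ (-p), by positivity, fun ε hε => ?_⟩
  have hεp : 0 < ε ^ p := by positivity
  rcases le_or_gt ε₁ ε with hbig | hsmall
  · refine (prob_le_one).trans_lt ?_
    rw [← ENNReal.ofReal_one, ENNReal.ofReal_lt_ofReal_iff (by positivity)]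
    have h1 : ε₁ ^ p ≤ ε ^ p := Real.rpow_le_rpow hε₁0.le hbig hp.le
    have h2 : ε₁ ^ (-p) * ε₁ ^ p = 1 := by rw [← Real.rpow_add hε₁0]; simp
    have h3 : ε₁ ^ (-p) * ε₁ ^ p ≤ ε₁ ^ (-p) * ε ^ p := by gcongr
    have h4 : 0 < (Ct + 1) * ε ^ p := by positivity
    linarith
  have hε1 : ε < 1 := hsmall.trans_le (min_le_right _ _)
  have hD := hsub ⟨hε, hsmall.trans_le (min_le_left _ _)⟩
  set Λ : ℝ := ε ^ (-κ) with hΛdef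
  have hΛ : 1 ≤ Λ := Real.one_le_rpow_of_pos_of_le_one_of_nonpos hε hε1.le (by linarith)
  have hΛp : Λ ^ (-(p / κ)) = ε ^ p := by
    rw [hΛdef, ← Real.rpow_mul hε.le]
    congr 1
    field_simp
  set N : Set Ω := {ω | ¬ ContinuousOn (fun t => a t ω) (Icc 0 1)} with hN
  set Ea : Set Ω :=
    {ω | ¬ (HolderBdd α Λ (fun t => a t ω) ∧ ∀ t ∈ Icc (0 : ℝ) 1, |a t ω| ≤ Λ)} with hEa
  set Eb : Fin m → Set Ω := fun i =>
    {ω | ¬ (HolderBdd α Λ (fun t => b t ω i) ∧ ∀ t ∈ Icc (0 : ℝ) 1, |b t ω i| ≤ Λ)} with hEb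
  set EB : Fin m → Set Ω := fun i => {ω | ¬ HolderBdd α Λ (fun t => B i t ω)} with hEB
  set S : Set Ω := {ω | ∃ k ∈ Finset.range (⌈1 / ε⌉₊ + 2),
        ∃ z ∈ Fintype.piFinset fun _ : Fin m => Finset.Icc (-⌈2 / ε ^ 2⌉) ⌈2 / ε ^ 2⌉,
        0 < k ∧ k * ε + K * L * ε + ε < 1 ∧ (∃ i, ε ^ β ≤ |ε * z i|) ∧
        ∀ j : Fin K, |∑ i, ε * z i * (B i (k * ε + j * L * ε + ε) ω - B i (k * ε + j * L * ε) ω)| ≤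
          ε ^ (1 - 3 * κ)} with hS
  have hN0 : P N = 0 := ha_cont
  have bEa : P Ea ≤ ENNReal.ofReal (Ca * ε ^ p) := by rw [← hΛp]; exact hta Λ hΛ
  have bEb : P (⋃ i, Eb i) ≤ ENNReal.ofReal ((∑ i, Cb i) * ε ^ p) := by
    rw [Finset.sum_mul]
    exact measure_iUnion_le_sum_ofReal (fun i => (mul_pos (hCb i) hεp).le)
      fun i => by rw [← hΛp]; exact htb i Λ hΛ
  have bEB : P (⋃ i, EB i) ≤ ENNReal.ofReal ((∑ i, CB i) * ε ^ p) := by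
    rw [Finset.sum_mul]
    exact measure_iUnion_le_sum_ofReal (fun i => (mul_pos (hCB i) hεp).le)
      fun i => by rw [← hΛp]; exact htB i Λ hΛ
  -- Monotonicity of the outer measure suffices here, so the event itself need not be measurable.
  have hcover : {ω | supNorm (fun t => norrisProcess a b B t ω) < ENNReal.ofReal ε ∧
      ENNReal.ofReal (ε ^ κ) < supNorm (fun t => a t ω) + supNorm (fun t => b t ω)} ⊆
      N ∪ (Ea ∪ ((⋃ i, Eb i) ∪ ((⋃ i, EB i) ∪ S))) := by
    rintro ω ⟨hy, hlarge⟩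
    by_contra hcon
    simp only [mem_union, mem_iUnion, not_or, not_exists, hN, hEa, hEb, hEB, mem_ofPred_eq,
      not_not] at hcon
    obtain ⟨g1, ⟨g2, g3⟩, g4, g5, g6⟩ := hcon
    -- For fixed ω, `norrisProcess` is by definition `norrisPath` of the sample paths.
    rcases hD (fun t => a t ω) (fun i t => b t ω i) (fun i t => B i t ω) g1 g2 g3
      (fun i => (g4 i).1) (fun i => (g4 i).2) g5 (abs_le_of_supNorm_lt hε hy) with h | h
    · have ha2 : supNorm (fun t => a t ω) ≤ ENNReal.ofReal (ε ^ κ / 2) :=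
        supNorm_le_ofReal fun t ht => (h t ht).1
      have hb2 : supNorm (fun t => b t ω) ≤ ENNReal.ofReal (ε ^ κ / 2) :=
        supNorm_le_ofReal fun t ht => (EuclideanSpace.norm_le_sum_abs _).trans (h t ht).2
      have := hlarge.trans_le (add_le_add ha2 hb2)
      rw [← ENNReal.ofReal_add (by positivity) (by positivity), add_halves] at this
      exact lt_irrefl _ this
    · exact g6 h
  calc _ ≤ P N + (P Ea + (P (⋃ i, Eb i) + (P (⋃ i, EB i) + P S))) :=
        (measure_mono hcover).trans ((measure_union_le _ _).trans (add_le_add le_rfl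
          ((measure_union_le _ _).trans (add_le_add le_rfl ((measure_union_le _ _).trans
            (add_le_add le_rfl (measure_union_le _ _)))))))
    _ ≤ 0 + (ENNReal.ofReal (Ca * ε ^ p) + (ENNReal.ofReal ((∑ i, Cb i) * ε ^ p) +
          (ENNReal.ofReal ((∑ i, CB i) * ε ^ p) + ENNReal.ofReal (CS * ε ^ p)))) := by
        gcongr
        · exact hN0.le
        · exact hSU ε hε hε1
    _ = ENNReal.ofReal (Ct * ε ^ p) := by
        rw [zero_add, ← ENNReal.ofReal_add (by positivity) (by positivity),
          ← ENNReal.ofReal_add (by positivity) (by positivity),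
          ← ENNReal.ofReal_add (by positivity) (by positivity)]
        congr 1
        rw [hCt]
        ring
    _ < _ := by
        rw [ENNReal.ofReal_lt_ofReal_iff (by positivity)]
        have : 0 < ε₁ ^ (-p) := by positivity
        gcongr
        linarith
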